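/- Let $p$ be a prime, $r\ge 1$, let $n_1,\dots,n_r\ge 1$ be integers and let $\xi_1,\dots,\xi_r\in\mathbb{C}_p$ with $|\xi_j|_p=1$ for all $j$. Let $\mathrm{red}:\mathbf{P}^1(\mathbb{C}_p)\to\mathbf{P}^1(\overline{\mathbb{F}}_p)$ be the reduction map, put $$S=\Bigl\{\mathrm{red}\bigl((\xi_j\xi_{j+1}\cdots\xi_r)^{-1}\bigr)\ :\ 1\le j\le r\Bigr\},\qquad ]S[\;=\mathrm{red}^{-1}(S).$$ For $z\in\mathbb{C}_p$ with $|z|_p<1$, and for integers $\alpha_1,\dots,\alpha_r$ with $0<\alpha_j<p$, let $$\ell^{(p)}_{n_1,\dots,n_r}(\xi_1,\dots,\xi_r;z)=\sum_{\substack{0<k_1<\cdots<k_r\\ p\nmid k_1,\dots,p\nmid k_r}}\frac{\xi_1^{k_1}\cdots\xi_r^{k_r}}{k_1^{n_1}\cdots k_r^{n_r}}\,z^{k_r},\qquad \ell^{\equiv(\alpha_1,\dots,\alpha_r),(p)}_{n_1,\dots,n_r}(\xi_1,\dots,\xi_r;z)=\sum_{\substack{0<k_1<\cdots<k_r\\ k_j\equiv\alpha_j\,(p)\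 \forall j}}\frac{\xi_1^{k_1}\cdots\xi_r^{k_r}}{k_1^{n_1}\cdots k_r^{n_r}}\,z^{k_r}.$$ A rigid analytic function on a set $X=\{z\in\mathbf{P}^1(\mathbb{C}_p): |z-\beta_i|_p\ge\delta_i\ (1\le i\le N),\ |z|_p\le 1/\delta_0\}$ with $\beta_i\in\mathbb{C}_p$, $\delta_i>0$, $\delta_0\ge 0$ is a function on $X$ with an expansion $$f(z)=\sum_{m\ge 0}a_mz^m+\sum_{i=1}^N\sum_{m\ge 1}\frac{b_{i,m}}{(z-\beta_i)^m},\qquad |b_{i,m}|_p\,\delta_i^{-m}\to 0,$$ where $|a_m|_p\,\delta_0^{-m}\to 0$ if $\delta_0>0$, and $a_m=0$ for all $m\ge 1$ if $\delta_0=0$. A function on $\mathbf{P}^1(\mathbb{C}_p)-]S[$ is overconvergent if it is the restriction of a rigid analytic function on the complement in $\mathbf{P}^1(\mathbb{C}_p)$ of the open discs of radius $\lambda$ around lifts of the points of $S$, for some $0<\lambda<1$. Then both series converge for all $|z|_p<1$, and each of the functions $\ell^{(p)}_{n_1,\dots,n_r}(\xi_1,\dots,\xi_r;z)$ and, for all $\alpha_1,\dots,\alpha_r$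 as above, $\ell^{\equiv(\alpha_1,\dots,\alpha_r),(p)}_{n_1,\dots,n_r}(\xi_1,\dots,\xi_r;z)$ extends from the open unit disc to a unique rigid analytic function on $\mathbf{P}^1(\mathbb{C}_p)-]S[$, and this extension is an overconvergent function of $\mathbf{P}^1\setminus S$. -/

import Mathlib

namespace RigidTMPL

open Filter Topology

noncomputable section

/-- The residue field of the ring of integers of `ℂ_p` (an algebraic closure of `𝔽_p`). -/
abbrev ResField (p : ℕ) [Fact p.Prime] : Type := IsLocalRing.ResidueField (𝓞_ℂ_[p])

/-- The projective line over `ℂ_p`, as `ℂ_p ∪ {∞}`. -/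
abbrev P1 (p : ℕ) [Fact p.Prime] : Type := OnePoint ℂ_[p]

/-- The projective line over the residue field. -/
abbrev P1Res (p : ℕ) [Fact p.Prime] : Type := OnePoint (ResField p)

open Classical in
/-- The reduction map: `∞` and all points outside the ring of integers reduce to `∞`, an integer
reduces to its residue class. -/
def red {p : ℕ} [Fact p.Prime] (z : P1 p) : P1Res p :=
  z.elim OnePoint.infty
    (fun w : ℂ_[p] => if h : w ∈ 𝓞_ℂ_[p] then
        ((IsLocalRing.residue (𝓞_ℂ_[p]) ⟨w, h⟩ : ResField p) : P1Res p)
      else OnePoint.infty)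

/-- The tubular neighbourhood `]S[`, the union of the residue discs of the points of `S`. -/
def tube {p : ℕ} [Fact p.Prime] (S : Set (P1Res p)) : Set (P1 p) := red ⁻¹' S

/-- The subset `{z | |z - α i| ≥ δ i for all i, |z| ≤ 1 / δ₀}` of the projective line; for `δ₀ = 0`
the last condition is empty, so that `∞` belongs to the set exactly if `δ₀ = 0`. -/
def affinoid {p : ℕ} [Fact p.Prime] {N : ℕ} (α : Fin N → ℂ_[p]) (δ : Fin N → ℝ) (δ₀ : ℝ) :
    Set (P1 p) :=
  {z | (z = OnePoint.infty → δ₀ = 0) ∧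
    ∀ w : ℂ_[p], z = (w : P1 p) → (∀ i, δ i ≤ ‖w - α i‖) ∧ ‖w‖ * δ₀ ≤ 1}

/-- `f` is a rigid analytic function on `X`: the set `X` has a presentation as `affinoid α δ δ₀`
for which `f` has on `X` a convergent Mittag-Leffler expansion
`f(z) = ∑_{m ≥ 0} a_m z ^ m + ∑_i ∑_{m ≥ 0} b_{i,m} / (z - α i) ^ (m + 1)`.
The coefficient conditions say that each of the series converges on the closed disc in `P¹` that
belongs to it; for `δ₀ = 0` this disc is `P¹` and the first series is the constant `a_0`.
The value of the expansion at `∞` is `a_0`. -/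
def IsRigidAnalyticOn {p : ℕ} [Fact p.Prime] (X : Set (P1 p)) (f : P1 p → ℂ_[p]) : Prop :=
  ∃ (N : ℕ) (α : Fin N → ℂ_[p]) (δ : Fin N → ℝ) (δ₀ : ℝ)
    (a : ℕ → ℂ_[p]) (b : Fin N → ℕ → ℂ_[p]),
    (∀ i, 0 < δ i) ∧ 0 ≤ δ₀ ∧ X = affinoid α δ δ₀ ∧
    (δ₀ = 0 → ∀ m, 1 ≤ m → a m = 0) ∧
    (0 < δ₀ → Tendsto (fun m : ℕ => ‖a m‖ * (1 / δ₀) ^ m) atTop (𝓝 0)) ∧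
    (∀ i, Tendsto (fun m : ℕ => ‖b i m‖ * (1 / δ i) ^ (m + 1)) atTop (𝓝 0)) ∧
    (∀ w : ℂ_[p], (w : P1 p) ∈ X →
      f (w : P1 p) = ∑' m, a m * w ^ m + ∑ i, ∑' m, b i m / (w - α i) ^ (m + 1)) ∧
    (OnePoint.infty ∈ X → f OnePoint.infty = a 0)

/-- Membership in `A^rig(P¹ ∖ S) = A^rig(P¹(ℂ_p) - ]S[)`. -/
def IsRigid {p : ℕ} [Fact p.Prime] (S : Set (P1Res p)) (f : P1 p → ℂ_[p]) : Prop :=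
  IsRigidAnalyticOn (tube S)ᶜ f

/-- The set `U_c`, the complement in `P¹(ℂ_p)` of the discs of radius `c` around lifts of the
points of `S`; here `lift s` is the lift of a finite point `s` and `∞` is lifted to `∞`, with local
parameter `1 / z`. -/
def shrunkComplement {p : ℕ} [Fact p.Prime] (S : Set (P1Res p)) (lift : ResField p → ℂ_[p])
    (c : ℝ) : Set (P1 p) :=
  {z | (z = OnePoint.infty → OnePoint.infty ∉ S) ∧
    ∀ w : ℂ_[p], z = (w : P1 p) →
      (∀ s : ResField p, (s : P1Res p) ∈ S → c ≤ ‖w - lift s‖) ∧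
      (OnePoint.infty ∈ S → ‖w‖ * c ≤ 1)}

/-- Membership in `A^†(P¹ ∖ S)`: on `P¹(ℂ_p) - ]S[` the function `f` is the restriction of a rigid
analytic function on some `U_c` with `0 < c < 1`. -/
def IsOverconvergent {p : ℕ} [Fact p.Prime] (S : Set (P1Res p)) (f : P1 p → ℂ_[p]) : Prop :=
  ∃ (lift : ResField p → ℂ_[p]) (c : ℝ) (F : P1 p → ℂ_[p]),
    (∀ s : ResField p, (s : P1Res p) ∈ S → red (lift s : P1 p) = (s : P1Res p)) ∧
    0 < c ∧ c < 1 ∧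
    IsRigidAnalyticOn (shrunkComplement S lift c) F ∧ Set.EqOn F f (tube S)ᶜ

/-- The term `ξ_1^{k_1} ⋯ ξ_r^{k_r} / (k_1^{n_1} ⋯ k_r^{n_r}) * z^{k_r}`; the depth is `r + 1` and
the indices run from `0` to `r`. -/
def term {p : ℕ} [Fact p.Prime] {r : ℕ} (n : Fin (r + 1) → ℕ) (ξ : Fin (r + 1) → ℂ_[p])
    (z : ℂ_[p]) (k : Fin (r + 1) → ℕ) : ℂ_[p] :=
  (∏ j, ξ j ^ k j) / (∏ j, (k j : ℂ_[p]) ^ n j) * z ^ k (Fin.last r)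

/-- Tuples `0 < k_1 < ⋯ < k_r` of integers prime to `p`. -/
def indexSet (p r : ℕ) : Set (Fin (r + 1) → ℕ) :=
  {k | 0 < k 0 ∧ StrictMono k ∧ ∀ j, (k j).Coprime p}

/-- Tuples `0 < k_1 < ⋯ < k_r` with `k_j ≡ α_j` modulo `p`. -/
def partialIndexSet (p : ℕ) {r : ℕ} (α : Fin (r + 1) → ℕ) : Set (Fin (r + 1) → ℕ) :=
  {k | 0 < k 0 ∧ StrictMono k ∧ ∀ j, k j ≡ α j [MOD p]}

/-- The `p`-adic rigid twisted multiple polylogarithm on the open unit disc. -/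
def rigidTMPL {p : ℕ} [Fact p.Prime] {r : ℕ} (n : Fin (r + 1) → ℕ) (ξ : Fin (r + 1) → ℂ_[p])
    (z : ℂ_[p]) : ℂ_[p] :=
  ∑' k : indexSet p r, term n ξ z k

/-- The `p`-adic partial twisted multiple polylogarithm on the open unit disc. -/
def partialTMPL {p : ℕ} [Fact p.Prime] {r : ℕ} (α n : Fin (r + 1) → ℕ)
    (ξ : Fin (r + 1) → ℂ_[p]) (z : ℂ_[p]) : ℂ_[p] :=
  ∑' k : partialIndexSet p α, term n ξ z k

/-- The set of the reductions of `(ξ_j ξ_{j+1} ⋯ ξ_r)⁻¹` for all `j`. -/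
def singularSet {p : ℕ} [Fact p.Prime] {r : ℕ} (ξ : Fin (r + 1) → ℂ_[p]) : Set (P1Res p) :=
  Set.range fun j : Fin (r + 1) => red (((∏ i ∈ Finset.Ici j, ξ i)⁻¹ : ℂ_[p]) : P1 p)

end

end RigidTMPL

/-! Summing over the gaps `k_j - k_{j-1} = g_j + p * d_j`, with `g_j` in `[1, p]` fixed by the
residues `α`, turns the partial series into `∑_d G(d) ∏_i h_i ^ (g_i + p * d_i)`, where `h_i = η_i *
z`, `η_i = ξ_i ⋯ ξ_r`, and `G` is a product of inverses of linear functions of `d` that are units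
modulo `p`. Such weights vary slowly: a step in the first variable changes `G` by `p * H` with `H`
of the same kind (`exists_fwdDiff_eq_of_mem_invLinearRing`). Summation by parts
(`progressionSum_succ`) therefore gives `S(G) = h ^ g / (1 - h ^ p) * S' + p * h ^ p / (1 - h ^ p) *
S(H)`, where `h`, `g` belong to the first variable and `S'` has one variable less. Iterating removes
the first variable at the cost of a `p`-adically convergent series, and induction on the depth
finishes (`IsNullClosed.progressionSum_mem`).

All this happens in a ring of functions on the open unit disc: convergent sums of powers of `γ / (w
- β_i)` with integral coefficients tending to zero, where the `β_i` lift the points of `S`. Partial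
fractions make it a ring, and membership is overconvergence of radius `‖γ‖`. It contains `γ / (1 -
η_i * w)` once `‖γ‖` exceeds the distance from `η_i⁻¹` to its lift, and, by the Frobenius
congruence, the kernels `γ ^ p * h ^ m / (1 - h ^ p)` for `m ≤ p` once `‖p‖ < ‖γ‖ ^ p`. Both
conditions hold for `‖γ‖` close enough to `1`. The full series is a finite sum of partial ones.

For uniqueness, a rigid function is a uniform limit of quotients `P / Q` with controlled `Q`. If it
vanishes on the open unit disc, then `P` is small there, so by the Gauss norm its coefficients are
small, and hence `P / Q` is small on the whole affinoid (`IsUniformLimit.eq_zero`). -/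

open Filter Topology

namespace RigidTMPL

/-! ### Rings of convergent integral combinations of bounded functions. -/

section NullSums

variable {K : Type*} [NormedField K] [IsUltrametricDist K] {D ι : Type*}

/-- The functions on `D` that are convergent combinations of the `e i` with integral coefficients
tending to zero. -/
def nullSums (e : ι → D → K) : Set (D → K) :=
  {f | ∃ b : ι → K, (∀ i, ‖b i‖ ≤ 1) ∧ Tendsto b cofinite (𝓝 0) ∧
    ∀ w, HasSum (fun i => b i * e i w) (f w)}

theorem norm_le_of_hasSum {f : ι → K} {a : K} (hf : HasSum f a) {C : ℝ} (hC : 0 ≤ C)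
    (h : ∀ i, ‖f i‖ ≤ C) : ‖a‖ ≤ C :=
  hf.tsum_eq ▸ IsUltrametricDist.norm_tsum_le_of_forall_le_of_nonneg hC h

theorem norm_le_one_of_mem_nullSums {e : ι → D → K} (he : ∀ i w, ‖e i w‖ ≤ 1) {f : D → K}
    (hf : f ∈ nullSums e) (w : D) : ‖f w‖ ≤ 1 := by
  obtain ⟨b, hb, -, hs⟩ := hf
  refine norm_le_of_hasSum (hs w) zero_le_one fun i => ?_
  rw [norm_mul]
  exact mul_le_one₀ (hb i) (norm_nonneg _) (he i w)

omit [IsUltrametricDist K] in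
theorem tendsto_cofinite_zero_iff_finite {f : ι → K} :
    Tendsto f cofinite (𝓝 0) ↔ ∀ ε > 0, {i | ε ≤ ‖f i‖}.Finite := by
  rw [Metric.tendsto_nhds]
  simp only [dist_zero_right, eventually_cofinite, not_lt]

omit [IsUltrametricDist K] in
theorem mem_nullSums_basis {e : ι → D → K} (i : ι) : e i ∈ nullSums e := by
  classical
  refine ⟨Pi.single i 1, fun j => ?_, ?_, fun w => ?_⟩
  · by_cases h : j = i
    · subst h; simp
    · simp [h]
  · refine tendsto_cofinite_zero_iff_finite.2 fun ε hε => (Set.finite_singleton i).subset ?_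
    intro j hj
    by_contra h
    have h' : j ≠ i := h
    simp only [Set.mem_ofPred_eq, Pi.single_eq_of_ne h', norm_zero] at hj
    linarith
  · convert hasSum_single (f := fun j => (Pi.single i 1 : ι → K) j * e j w) i ?_ using 1
    · simp
    · intro j hj
      simp [hj]

variable [CompleteSpace K]

theorem summable_of_cofinite {f : ι → K} (h : Tendsto f cofinite (𝓝 0)) : Summable f :=
  NonarchimedeanAddGroup.summable_of_tendsto_cofinite_zero h

omit [IsUltrametricDist K] [CompleteSpace K] in
theorem tendsto_zero_of_norm_le {κ : Type*} {f : κ → K} {g : κ → K} {l : Filter κ}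
    (hg : Tendsto g l (𝓝 0)) (h : ∀ i, ‖f i‖ ≤ ‖g i‖) : Tendsto f l (𝓝 0) :=
  squeeze_zero_norm h (tendsto_zero_iff_norm_tendsto_zero.1 hg)

/-- The products of the coefficients form a null family on `J × ι`. Over a complete nonarchimedean
field it may be summed in either order, so collecting the coefficient of each `e i` is legitimate.
-/
theorem mem_nullSums_of_hasSum {e : ι → D → K} (he : ∀ i w, ‖e i w‖ ≤ 1) {J : Type*} {x : J → K}
    (hx : ∀ j, ‖x j‖ ≤ 1) (hx0 : Tendsto x cofinite (𝓝 0)) {a : J → D → K}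
    (ha : ∀ j, a j ∈ nullSums e) {f : D → K} (hf : ∀ w, HasSum (fun j => x j * a j w) (f w)) :
    f ∈ nullSums e := by
  choose b hb1 hb0 hbs using ha
  have hprod : Tendsto (fun q : J × ι => x q.1 * b q.1 q.2) cofinite (𝓝 0) := by
    refine tendsto_cofinite_zero_iff_finite.2 fun ε hε => ?_
    have h1 := tendsto_cofinite_zero_iff_finite.1 hx0 ε hε
    refine (h1.biUnion fun j _ => ((tendsto_cofinite_zero_iff_finite.1 (hb0 j) ε hε).image
      (Prod.mk j))).subset ?_
    rintro ⟨j, i⟩ hji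
    simp only [Set.mem_ofPred_eq, norm_mul] at hji
    simp only [Set.mem_iUnion, Set.mem_image, Set.mem_ofPred_eq]
    refine ⟨j, hji.trans (mul_le_of_le_one_right (norm_nonneg _) (hb1 _ _)), i,
      hji.trans (mul_le_of_le_one_left (norm_nonneg _) (hx _)), rfl⟩
  have hswap : Tendsto (fun q : ι × J => x q.2 * b q.2 q.1) cofinite (𝓝 0) :=
    hprod.comp (Equiv.prodComm ι J).injective.tendsto_cofinite
  have hle : ∀ j i, ‖x j * b j i‖ ≤ 1 := fun j i => by
    rw [norm_mul]
    exact mul_le_one₀ (hx j) (norm_nonneg _) (hb1 _ _)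
  have hsum : ∀ i, Summable fun j => x j * b j i := fun i =>
    (summable_of_cofinite hswap).prod_factor i
  refine ⟨fun i => ∑' j, x j * b j i, fun i => ?_, ?_, fun w => ?_⟩
  · exact norm_le_of_hasSum (hsum i).hasSum zero_le_one fun j => hle j i
  · refine tendsto_cofinite_zero_iff_finite.2 fun ε hε => ?_
    refine ((tendsto_cofinite_zero_iff_finite.1 hprod (ε / 2) (half_pos hε)).image
      Prod.snd).subset fun i hi => ?_
    by_contra hcon
    have : ∀ j, ‖x j * b j i‖ ≤ ε / 2 := fun j => by
      by_contra! hlt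
      exact hcon ⟨(j, i), hlt.le, rfl⟩
    have := norm_le_of_hasSum (hsum i).hasSum (half_pos hε).le this
    simp only [Set.mem_ofPred_eq] at hi
    linarith
  · have hF : Tendsto (fun q : J × ι => x q.1 * b q.1 q.2 * e q.2 w) cofinite (𝓝 0) :=
      tendsto_zero_of_norm_le hprod fun q => by
        rw [norm_mul]
        exact mul_le_of_le_one_right (norm_nonneg _) (he _ _)
    have hS := summable_of_cofinite hF
    have h1 : ∑' q : J × ι, x q.1 * b q.1 q.2 * e q.2 w = f w := by
      rw [← (hf w).tsum_eq, hS.tsum_prod]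
      refine tsum_congr fun j => ?_
      rw [← (hbs j w).tsum_eq, ← tsum_mul_left]
      exact tsum_congr fun i => mul_assoc _ _ _
    have h2 : HasSum (fun q : ι × J => x q.2 * b q.2 q.1 * e q.1 w) (f w) := by
      rw [← h1]
      exact (Equiv.prodComm ι J).hasSum_iff.2 hS.hasSum
    refine h2.prod_fiberwise fun i => ?_
    exact (hsum i).hasSum.mul_right _

/-- The subring of the functions in `nullSums e`, for a multiplicatively closed family `e`. -/
def nullSumRing (e : ι → D → K) (he : ∀ i w, ‖e i w‖ ≤ 1) (h1 : 1 ∈ nullSums e)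
    (hmul : ∀ i j, e i * e j ∈ nullSums e) : Subring (D → K) where
  carrier := nullSums e
  one_mem' := h1
  zero_mem' := ⟨0, by simp, tendsto_const_nhds, fun w => by simp⟩
  add_mem' := by
    intro f g hf hg
    refine mem_nullSums_of_hasSum he (J := Fin 2) (x := fun _ => 1) (by simp)
      (by rw [cofinite_eq_bot]; exact tendsto_bot) (a := ![f, g]) ?_ fun w => ?_
    · intro j
      fin_cases j <;> assumption
    · simpa [Fin.sum_univ_two] using hasSum_fintype fun j : Fin 2 => (1 : K) * ![f, g] j w
  neg_mem' := by
    rintro f ⟨b, hb1, hb0, hbs⟩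
    refine ⟨fun i => -b i, by simpa using hb1, by simpa using hb0.neg, fun w => ?_⟩
    simpa [neg_mul] using (hbs w).neg
  mul_mem' := by
    rintro f g ⟨b, hb1, hb0, hbs⟩ ⟨c, hc1, hc0, hcs⟩
    refine mem_nullSums_of_hasSum he (J := ι × ι) (x := fun q => b q.1 * c q.2) ?_ ?_
      (a := fun q => e q.1 * e q.2) (fun q => hmul _ _) fun w => ?_
    · intro q
      rw [norm_mul]
      exact mul_le_one₀ (hb1 _) (norm_nonneg _) (hc1 _)
    · refine tendsto_cofinite_zero_iff_finite.2 fun ε hε => ?_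
      refine ((tendsto_cofinite_zero_iff_finite.1 hb0 ε hε).prod
        (tendsto_cofinite_zero_iff_finite.1 hc0 ε hε)).subset ?_
      rintro ⟨i, j⟩ hij
      simp only [Set.mem_ofPred_eq, norm_mul] at hij
      exact ⟨hij.trans (mul_le_of_le_one_right (norm_nonneg _) (hc1 _)),
        hij.trans (mul_le_of_le_one_left (norm_nonneg _) (hb1 _))⟩
    · have : NonarchimedeanRing K :=
        { is_nonarchimedean := NonarchimedeanAddGroup.is_nonarchimedean }
      refine ((hbs w).mul_of_nonarchimedean (hcs w)).congr_fun fun q => ?_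
      simp only [Pi.mul_apply]
      ring

/-- A subring of functions bounded by `1` that is closed under combinations with integral
coefficients tending to zero. -/
structure IsNullClosed (A : Subring (D → K)) : Prop where
  norm_le_one : ∀ f ∈ A, ∀ w, ‖f w‖ ≤ 1
  mem_of_hasSum : ∀ (x : ℕ → K), (∀ j, ‖x j‖ ≤ 1) → Tendsto x cofinite (𝓝 0) →
    ∀ a : ℕ → D → K, (∀ j, a j ∈ A) → ∀ f : D → K,
    (∀ w, HasSum (fun j => x j * a j w) (f w)) → f ∈ A
  smul_mem : ∀ (x : K), ‖x‖ ≤ 1 → ∀ a ∈ A, (fun w => x * a w) ∈ A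

theorem isNullClosed_nullSumRing (e : ι → D → K) (he : ∀ i w, ‖e i w‖ ≤ 1) (h1 : 1 ∈ nullSums e)
    (hmul : ∀ i j, e i * e j ∈ nullSums e) : IsNullClosed (nullSumRing e he h1 hmul) where
  norm_le_one f hf w := norm_le_one_of_mem_nullSums he hf w
  mem_of_hasSum x hx hx0 a ha f hf := mem_nullSums_of_hasSum he hx hx0 ha hf
  smul_mem := by
    rintro x hx a ⟨b, hb1, hb0, hbs⟩
    refine ⟨fun i => x * b i, fun i => ?_, by simpa using hb0.const_mul x, fun w => ?_⟩
    · rw [norm_mul]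
      exact mul_le_one₀ hx (norm_nonneg _) (hb1 _)
    · simpa [mul_assoc] using (hbs w).mul_left x

namespace IsNullClosed

variable {A : Subring (D → K)} (hA : IsNullClosed A)
include hA

omit [IsUltrametricDist K] [CompleteSpace K] in
theorem const_mem {x : K} (hx : ‖x‖ ≤ 1) : (fun _ => x) ∈ A := by
  simpa using hA.smul_mem x hx 1 A.one_mem

omit [IsUltrametricDist K] [CompleteSpace K] in
theorem mem_of_hasSum_pow {t : K} (ht : ‖t‖ < 1) {a : ℕ → D → K} (ha : ∀ j, a j ∈ A) {f : D → K}
    (hf : ∀ w, HasSum (fun j => t ^ j * a j w) (f w)) : f ∈ A := by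
  refine hA.mem_of_hasSum (fun j => t ^ j) (fun j => ?_) ?_ a ha f hf
  · rw [norm_pow]
    exact pow_le_one₀ (norm_nonneg _) ht.le
  · rw [Nat.cofinite_eq_atTop]
    exact tendsto_pow_atTop_nhds_zero_of_norm_lt_one ht

omit [IsUltrametricDist K] [CompleteSpace K] in
theorem norm_mul_lt_one {t : K} (ht : ‖t‖ < 1) {a : D → K} (ha : a ∈ A) (w : D) :
    ‖t * a w‖ < 1 := by
  rw [norm_mul]
  exact (mul_le_of_le_one_right (norm_nonneg _) (hA.norm_le_one a ha w)).trans_lt ht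

omit [IsUltrametricDist K] [CompleteSpace K] in
theorem inv_one_sub_mem {t : K} (ht : ‖t‖ < 1) {a : D → K} (ha : a ∈ A) :
    (fun w => (1 - t * a w)⁻¹) ∈ A := by
  refine hA.mem_of_hasSum_pow ht (a := fun j => a ^ j) (fun j => A.pow_mem ha j) fun w => ?_
  simpa [mul_pow] using hasSum_geometric_of_norm_lt_one (hA.norm_mul_lt_one ht ha w)

/-- Unfolding the recursion gives `x = ∑_j t ^ j * a ^ j * c_j`. The remainder after `n` steps is at
most `‖t‖ ^ n` because `X` is uniformly bounded, so membership of `X` in `A` need not be known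
beforehand. -/
theorem subset_of_recursion {X : Set (D → K)} (hX : ∀ x ∈ X, ∀ w, ‖x w‖ ≤ 1) {t : K}
    (ht : ‖t‖ < 1) {a : D → K} (ha : a ∈ A)
    (h : ∀ x ∈ X, ∃ y ∈ X, ∃ c ∈ A, ∀ w, x w = c w + t * a w * y w) : ∀ x ∈ X, x ∈ A := by
  intro x hx
  choose! y hy c hc hxy using h
  have hyn : ∀ n, y^[n] x ∈ X := fun n => by
    induction n with
    | zero => exact hx
    | succ n ih => rw [Function.iterate_succ_apply']; exact hy _ ih
  refine hA.mem_of_hasSum_pow ht (a := fun j => a ^ j * c (y^[j] x))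
    (fun j => A.mul_mem (A.pow_mem ha j) (hc _ (hyn j))) fun w => ?_
  have hlim : Tendsto (fun n : ℕ => ‖t‖ ^ n) atTop (𝓝 0) :=
    tendsto_pow_atTop_nhds_zero_of_lt_one (norm_nonneg _) ht
  have hpart : ∀ n, x w = ∑ j ∈ Finset.range n, t ^ j * (a ^ j * c (y^[j] x)) w +
      (t * a w) ^ n * (y^[n] x) w := fun n => by
    induction n with
    | zero => simp
    | succ n ih =>
      rw [ih, Finset.sum_range_succ, hxy _ (hyn n) w, Function.iterate_succ_apply']
      simp only [Pi.mul_apply, Pi.pow_apply]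
      ring
  have hbound : ∀ f ∈ A, ∀ j : ℕ, ‖t ^ j * (a ^ j * f) w‖ ≤ ‖t‖ ^ j := fun f hf j => by
    rw [norm_mul, norm_pow]
    exact mul_le_of_le_one_right (by positivity)
      (hA.norm_le_one _ (A.mul_mem (A.pow_mem ha j) hf) w)
  have hsum : Summable fun j => t ^ j * (a ^ j * c (y^[j] x)) w := by
    refine summable_of_cofinite ?_
    rw [Nat.cofinite_eq_atTop]
    exact squeeze_zero_norm (fun j => hbound _ (hc _ (hyn j)) j) hlim
  refine (hsum.hasSum_iff_tendsto_nat).2 ?_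
  have hrem : Tendsto (fun n => (t * a w) ^ n * (y^[n] x) w) atTop (𝓝 0) := by
    refine squeeze_zero_norm (fun n => ?_) hlim
    rw [norm_mul, norm_pow]
    refine (mul_le_of_le_one_right (by positivity) (hX _ (hyn n) w)).trans ?_
    refine pow_le_pow_left₀ (norm_nonneg _) ?_ n
    rw [norm_mul]
    exact mul_le_of_le_one_right (norm_nonneg _) (hA.norm_le_one a ha w)
  have := (tendsto_const_nhds (x := x w)).sub hrem
  rw [sub_zero] at this
  refine this.congr fun n => ?_
  rw [hpart n]
  ring

end IsNullClosed

end NullSums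

/-! ### Multiple power series over arithmetic progressions with slowly varying weights. -/

section PowerSums

variable {K : Type*} [NormedField K]

section Kernel

variable {D : Type*} {A : Subring (D → K)} (hA : IsNullClosed A)
include hA

/-- If `γ / (1 - h)` lies in `A` then so does `γ ^ p * h ^ g / (1 - h ^ p)` for `g ≤ p`. -/
theorem IsNullClosed.pow_mul_inv_one_sub_pow_mem {p : ℕ} (hp : p.Prime) {γ : K} (hγ : ‖γ‖ ≤ 1)
    (hpγ : ‖(p : K)‖ < ‖γ‖ ^ p) {h : D → K} (h1 : ∀ w, h w ≠ 1)
    (hY : (fun w => γ * (1 - h w)⁻¹) ∈ A) {g : ℕ} (hg : g ≤ p) :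
    (fun w => γ ^ p * (h w ^ g * (1 - h w ^ p)⁻¹)) ∈ A := by
  have hγ0 : γ ≠ 0 := by
    rintro rfl
    rw [norm_zero, zero_pow hp.ne_zero] at hpγ
    exact absurd hpγ (norm_nonneg _).not_gt
  have hγp : γ ^ p ≠ 0 := pow_ne_zero _ hγ0
  set X : D → K := fun w => γ * (1 - h w)⁻¹ with hX
  have hγA : (fun _ => γ) ∈ A := hA.const_mem hγ
  have hXA : X - (fun _ => γ) ∈ A := A.sub_mem hY hγA
  -- For `X = γ / (1 - h)` one has `X - γ = h * X`. The congruence `X ^ p ≡ (X - γ) ^ p + γ ^ p`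
  -- modulo `p * A` thus says `X ^ p * (1 - h ^ p) = γ ^ p + p * R`, and the right side is `γ ^ p`
  -- times a unit of `A`.
  obtain ⟨⟨R, hR⟩, hr⟩ : ∃ R : A, (⟨X, hY⟩ : A) ^ p =
      (⟨X - fun _ => γ, hXA⟩ : A) ^ p + (⟨_, hγA⟩ : A) ^ p + p * R := by
    obtain ⟨r, hr⟩ := exists_add_pow_prime_eq hp (⟨X - fun _ => γ, hXA⟩ : A) (⟨_, hγA⟩ : A)
    refine ⟨⟨X - fun _ => γ, hXA⟩ * ⟨_, hγA⟩ * r, ?_⟩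
    rw [← mul_assoc, ← mul_assoc, ← hr]
    congr 1
    ext1
    simp
  have hr' : ∀ w, X w ^ p = (X w - γ) ^ p + γ ^ p + p * R w := fun w =>
    congrFun (congrArg Subtype.val hr) w
  have ht : ‖-((p : K) / γ ^ p)‖ < 1 := by
    rw [norm_neg, norm_div, norm_pow, div_lt_one (pow_pos (norm_pos_iff.2 hγ0) _)]
    exact hpγ
  -- The first two factors multiply to `h ^ g * X ^ p`, which is where `g ≤ p` enters.
  have hmem := A.mul_mem (A.mul_mem (A.pow_mem hXA g) (A.pow_mem hY (p - g)))
    (hA.inv_one_sub_mem ht hR)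
  convert hmem using 1
  funext w
  have hw : 1 - h w ≠ 0 := sub_ne_zero.2 (h1 w).symm
  have hXw : X w * (1 - h w) = γ := by simp [hX, hw]
  have hX0 : X w ≠ 0 := by simp [hX, hw, hγ0]
  have hXh : X w - γ = h w * X w := by rw [← hXw]; ring
  have hkey : X w ^ p * (1 - h w ^ p) = γ ^ p * (1 - -((p : K) / γ ^ p) * R w) := by
    have := hr' w
    rw [hXh, mul_pow] at this
    field_simp
    linear_combination this
  have hsplit : X w ^ p = X w ^ g * X w ^ (p - g) := by rw [← pow_add, Nat.add_sub_cancel' hg]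
  simp only [Pi.mul_apply, Pi.pow_apply, Pi.sub_apply]
  rw [hXh, mul_pow, mul_assoc (h w ^ g), ← hsplit, mul_left_comm, mul_assoc]
  congr 1
  rw [← div_eq_mul_inv, ← div_eq_mul_inv]
  have hX0p := pow_ne_zero p hX0
  have hI : 1 - -((p : K) / γ ^ p) * R w ≠ 0 := fun h0 => by
    have := hA.norm_mul_lt_one ht hR w
    rw [sub_eq_zero] at h0
    rw [← h0, norm_one] at this
    exact lt_irrefl _ this
  have hJ : 1 - h w ^ p ≠ 0 := fun h0 => by
    rw [h0, mul_zero] at hkey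
    exact mul_ne_zero hγp hI hkey.symm
  rw [div_eq_div_iff hJ hI, hkey]

end Kernel

section Slowly

/-- The ring of functions on `ℕ ^ r` that is generated by the inverses of linear functions
`a + p * (c₁ d₁ + ⋯ + c_r d_r)` with `a` prime to `p`. -/
def invLinearRing (K : Type*) [NormedField K] (p r : ℕ) : Subring ((Fin r → ℕ) → K) :=
  Subring.closure {f | ∃ (a : ℕ) (c : Fin r → ℕ), a.Coprime p ∧
    f = fun d => ((a + p * ∑ i, c i * d i : ℕ) : K)⁻¹}

theorem coprime_add_mul {p a : ℕ} (ha : a.Coprime p) (m : ℕ) : (a + p * m).Coprime p := by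
  simpa using ha

theorem cons_zero_mem_invLinearRing {p r : ℕ} {G : (Fin (r + 1) → ℕ) → K}
    (hG : G ∈ invLinearRing K p (r + 1)) :
    (fun d => G (Fin.cons 0 d)) ∈ invLinearRing K p r := by
  induction hG using Subring.closure_induction with
  | mem f hf =>
    obtain ⟨a, c, ha, rfl⟩ := hf
    refine Subring.subset_closure ⟨a, fun i => c i.succ, ha, ?_⟩
    funext d
    simp [Fin.sum_univ_succ]
  | zero => exact Subring.zero_mem _
  | one => exact Subring.one_mem _
  | add f g _ _ hf hg => exact Subring.add_mem _ hf hg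
  | neg f _ hf => exact Subring.neg_mem _ hf
  | mul f g _ _ hf hg => exact Subring.mul_mem _ hf hg

variable [IsUltrametricDist K]

theorem norm_natCast_eq_one_of_coprime {p m : ℕ} (hp : ‖(p : K)‖ < 1) (hm : m.Coprime p) :
    ‖(m : K)‖ = 1 := by
  refine le_antisymm (IsUltrametricDist.norm_natCast_le_one K m) (not_lt.1 fun hlt => ?_)
  have hb : (m : K) * (m.gcdA p : ℤ) + p * (m.gcdB p : ℤ) = 1 := by
    have := congrArg (Int.cast : ℤ → K) (Nat.gcd_eq_gcd_ab m p)
    rw [hm.gcd_eq_one] at this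
    simpa using this.symm
  have h1 : ‖(m : K) * (m.gcdA p : ℤ)‖ < 1 := by
    rw [norm_mul]
    exact (mul_le_of_le_one_right (norm_nonneg _)
      (IsUltrametricDist.norm_intCast_le_one K _)).trans_lt hlt
  have h2 : ‖(p : K) * (m.gcdB p : ℤ)‖ < 1 := by
    rw [norm_mul]
    exact (mul_le_of_le_one_right (norm_nonneg _)
      (IsUltrametricDist.norm_intCast_le_one K _)).trans_lt hp
  have := (IsUltrametricDist.norm_add_le_max _ _).trans_lt (max_lt h1 h2)
  rw [hb, norm_one] at this
  exact lt_irrefl _ this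

theorem norm_le_one_of_mem_invLinearRing {p r : ℕ} (hp : ‖(p : K)‖ < 1) {G : (Fin r → ℕ) → K}
    (hG : G ∈ invLinearRing K p r) (d : Fin r → ℕ) : ‖G d‖ ≤ 1 := by
  induction hG using Subring.closure_induction with
  | mem f hf =>
    obtain ⟨a, c, ha, rfl⟩ := hf
    rw [norm_inv, norm_natCast_eq_one_of_coprime hp (coprime_add_mul ha _), inv_one]
  | zero => simp
  | one => simp
  | add f g _ _ hf hg => exact (IsUltrametricDist.norm_add_le_max _ _).trans (max_le hf hg)
  | neg f _ hf => simpa using hf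
  | mul f g _ _ hf hg =>
    rw [Pi.mul_apply, norm_mul]
    exact mul_le_one₀ hf (norm_nonneg _) hg

/-- On generators this is `1 / (x + p * c) - 1 / x = -p * c / (x * (x + p * c))`, and `x + p * c`
comes from replacing `a` by `a + p * c`. The product rule for differences extends it to the
generated ring. -/
theorem exists_fwdDiff_eq_of_mem_invLinearRing {p r : ℕ} (hp : ‖(p : K)‖ < 1)
    {G : (Fin (r + 1) → ℕ) → K} (hG : G ∈ invLinearRing K p (r + 1)) :
    ∃ H ∈ invLinearRing K p (r + 1), ∀ (m : ℕ) (d : Fin r → ℕ),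
      G (Fin.cons (m + 1) d) = G (Fin.cons m d) + p * H (Fin.cons m d) := by
  induction hG using Subring.closure_induction with
  | mem f hf =>
    obtain ⟨a, c, ha, rfl⟩ := hf
    have hgen : ∀ b : ℕ, b.Coprime p → (fun d : Fin (r + 1) → ℕ =>
        ((b + p * ∑ i, c i * d i : ℕ) : K)⁻¹) ∈ invLinearRing K p (r + 1) := fun b hb =>
      Subring.subset_closure ⟨b, c, hb, rfl⟩
    have hne : ∀ b m : ℕ, b.Coprime p → ((b + p * m : ℕ) : K) ≠ 0 := fun b m hb h0 => by
      have := norm_natCast_eq_one_of_coprime hp (coprime_add_mul hb m)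
      rw [h0, norm_zero] at this
      exact zero_ne_one this
    have ha' := coprime_add_mul ha (c 0)
    have hc : (c 0 : (Fin (r + 1) → ℕ) → K) ∈ invLinearRing K p (r + 1) := natCast_mem _ _
    refine ⟨_, Subring.neg_mem _ (Subring.mul_mem _ hc
      (Subring.mul_mem _ (hgen a ha) (hgen (a + p * c 0) ha'))), fun m d => ?_⟩
    have h1 := hne a (c 0 * m + ∑ i : Fin r, c i.succ * d i) ha
    have h2 := hne (a + p * c 0) (c 0 * m + ∑ i : Fin r, c i.succ * d i) ha'
    have h3 : a + p * (c 0 * (m + 1) + ∑ i : Fin r, c i.succ * d i) =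
      a + p * c 0 + p * (c 0 * m + ∑ i : Fin r, c i.succ * d i) := by ring
    simp only [Fin.sum_univ_succ, Fin.cons_zero, Fin.cons_succ, Pi.mul_apply, Pi.neg_apply,
      Pi.natCast_apply, h3]
    field_simp
    push_cast
    ring
  | zero => exact ⟨0, Subring.zero_mem _, by simp⟩
  | one => exact ⟨0, Subring.zero_mem _, by simp⟩
  | add f g _ _ hf hg =>
    obtain ⟨F, hF, hF'⟩ := hf
    obtain ⟨H, hH, hH'⟩ := hg
    refine ⟨F + H, Subring.add_mem _ hF hH, fun m d => ?_⟩
    simp only [Pi.add_apply, hF', hH']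
    ring
  | neg f _ hf =>
    obtain ⟨F, hF, hF'⟩ := hf
    refine ⟨-F, Subring.neg_mem _ hF, fun m d => ?_⟩
    simp only [Pi.neg_apply, hF']
    ring
  | mul f g hf0 hg0 hf hg =>
    obtain ⟨F, hF, hF'⟩ := hf
    obtain ⟨H, hH, hH'⟩ := hg
    -- In `Δ(f * g) = Δf * g(m + 1) + f * Δg` the shifted value `g(m + 1)` equals `g + p * H`.
    refine ⟨F * (g + p * H) + f * H, Subring.add_mem _ (Subring.mul_mem _ hF
      (Subring.add_mem _ hg0 (Subring.mul_mem _ (natCast_mem (invLinearRing K p (r + 1)) p) hH)))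
      (Subring.mul_mem _ hf0 hH), fun m d => ?_⟩
    simp only [Pi.add_apply, Pi.mul_apply, Pi.natCast_apply, hF', hH']
    ring

end Slowly

section Sums

variable [IsUltrametricDist K]

omit [IsUltrametricDist K] in
theorem tendsto_zero_of_norm_le_pow {ι : Type*} {f : ι → K} {ρ : ℝ} (h0 : 0 ≤ ρ) (h1 : ρ < 1)
    (φ : ι → ℕ) (hφ : ∀ N, {i | φ i ≤ N}.Finite) (h : ∀ i, ‖f i‖ ≤ ρ ^ φ i) :
    Tendsto f cofinite (𝓝 0) := by
  refine tendsto_cofinite_zero_iff_finite.2 fun ε hε => ?_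
  obtain ⟨N, hN⟩ := exists_pow_lt_of_lt_one hε h1
  refine (hφ N).subset fun i hi => ?_
  by_contra hcon
  have h2 : N ≤ φ i := (not_le.1 hcon).le
  have := (h i).trans (pow_le_pow_of_le_one h0 h1.le h2)
  simp only [Set.mem_ofPred_eq] at hi
  linarith

theorem finite_sum_le (r N : ℕ) : {d : Fin r → ℕ | ∑ i, d i ≤ N}.Finite :=
  (Set.finite_Iic fun _ => N).subset fun d hd i =>
    (Finset.single_le_sum (fun j _ => Nat.zero_le (d j)) (Finset.mem_univ i)).trans hd

/-- The multiple power series `∑_d G(d) ∏_i h_i ^ (g_i + p d_i)`. -/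
noncomputable def progressionSum {D : Type*} (p : ℕ) {r : ℕ} (h : Fin r → D → K) (g : Fin r → ℕ)
    (G : (Fin r → ℕ) → K) (w : D) : K :=
  ∑' d : Fin r → ℕ, (∏ i, h i w ^ (g i + p * d i)) * G d

omit [IsUltrametricDist K] in
theorem norm_prod_pow_le {D : Type*} {p r : ℕ} (hp0 : 0 < p) {h : Fin r → D → K} (g : Fin r → ℕ)
    {w : D} {ρ : ℝ} (hρ : ρ < 1) (hh : ∀ i, ‖h i w‖ ≤ ρ) (d : Fin r → ℕ) :
    ‖∏ i, h i w ^ (g i + p * d i)‖ ≤ ρ ^ ∑ i, d i := by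
  rw [norm_prod, ← Finset.prod_pow_eq_pow_sum]
  refine Finset.prod_le_prod (fun _ _ => norm_nonneg _) fun i _ => ?_
  rw [norm_pow]
  have hi := hh i
  have hd : d i ≤ g i + p * d i := (Nat.le_mul_of_pos_left _ hp0).trans (Nat.le_add_left _ _)
  calc ‖h i w‖ ^ (g i + p * d i) ≤ ‖h i w‖ ^ d i :=
        pow_le_pow_of_le_one (norm_nonneg _) (hi.trans hρ.le) hd
    _ ≤ ρ ^ d i := pow_le_pow_left₀ (norm_nonneg _) hi _

theorem exists_bound_lt_one {ι : Type*} [Finite ι] {f : ι → ℝ} (hf : ∀ i, f i < 1) :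
    ∃ ρ, 0 ≤ ρ ∧ ρ < 1 ∧ ∀ i, f i ≤ ρ := by
  cases nonempty_fintype ι
  rcases isEmpty_or_nonempty ι with he | he
  · exact ⟨0, le_rfl, zero_lt_one, fun i => he.elim i⟩
  · obtain ⟨i, hi⟩ := Finite.exists_max f
    exact ⟨max (f i) 0, le_max_right _ _, max_lt (hf i) zero_lt_one,
      fun j => (hi j).trans (le_max_left _ _)⟩

omit [IsUltrametricDist K] in
theorem tendsto_progressionSum {D : Type*} {p r : ℕ} (hp0 : 0 < p) {h : Fin r → D → K}
    (g : Fin r → ℕ) {w : D} (hh : ∀ i, ‖h i w‖ < 1) {G : (Fin r → ℕ) → K}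
    (hG : ∀ d, ‖G d‖ ≤ 1) :
    Tendsto (fun d : Fin r → ℕ => (∏ i, h i w ^ (g i + p * d i)) * G d) cofinite (𝓝 0) := by
  obtain ⟨ρ, h0, h1, hρ⟩ := exists_bound_lt_one hh
  refine tendsto_zero_of_norm_le_pow h0 h1 (fun d => ∑ i, d i) (finite_sum_le r) fun d => ?_
  rw [norm_mul]
  exact (mul_le_of_le_one_right (norm_nonneg _) (hG d)).trans
    (norm_prod_pow_le hp0 g h1 hρ d)

theorem norm_progressionSum_le_one {D : Type*} {p r : ℕ} {h : Fin r → D → K}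
    (g : Fin r → ℕ) {w : D} (hh : ∀ i, ‖h i w‖ < 1) {G : (Fin r → ℕ) → K}
    (hG : ∀ d, ‖G d‖ ≤ 1) : ‖progressionSum p h g G w‖ ≤ 1 := by
  refine IsUltrametricDist.norm_tsum_le_of_forall_le_of_nonneg zero_le_one fun d => ?_
  rw [norm_mul, norm_prod]
  refine mul_le_one₀ (Finset.prod_le_one (fun _ _ => norm_nonneg _) fun i _ => ?_)
    (norm_nonneg _) (hG d)
  rw [norm_pow]
  exact pow_le_one₀ (norm_nonneg _) (hh i).le

variable [CompleteSpace K]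

/-- Summation by parts in the first variable: multiplying by `1 - h 0 w ^ p` leaves the slice `m =
0` and the series of the differences. -/
theorem progressionSum_succ {D : Type*} {p r : ℕ} (hp0 : 0 < p) {h : Fin (r + 1) → D → K}
    (g : Fin (r + 1) → ℕ) {w : D} (hh : ∀ i, ‖h i w‖ < 1) {G H : (Fin (r + 1) → ℕ) → K}
    (hG : ∀ d, ‖G d‖ ≤ 1) (hH : ∀ d, ‖H d‖ ≤ 1) {c : K}
    (hGH : ∀ (m : ℕ) (d : Fin r → ℕ),
      G (Fin.cons (m + 1) d) = G (Fin.cons m d) + c * H (Fin.cons m d)) :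
    (1 - h 0 w ^ p) * progressionSum p h g G w =
      h 0 w ^ g 0 * progressionSum p (Fin.tail h) (Fin.tail g) (fun d => G (Fin.cons 0 d)) w +
      c * h 0 w ^ p * progressionSum p h g H w := by
  have hfib : ∀ F : (Fin (r + 1) → ℕ) → K, (∀ d, ‖F d‖ ≤ 1) →
      HasSum (fun m : ℕ => h 0 w ^ (g 0 + p * m) * progressionSum p (Fin.tail h) (Fin.tail g)
        (fun d => F (Fin.cons m d)) w) (progressionSum p h g F w) := fun F hF => by
    have h1 := (summable_of_cofinite (tendsto_progressionSum hp0 g hh hF)).hasSum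
    have h2 := (Fin.consEquiv fun _ : Fin (r + 1) => ℕ).hasSum_iff.2 h1
    refine h2.prod_fiberwise fun m => ?_
    have h3 := (summable_of_cofinite (tendsto_progressionSum hp0 (Fin.tail g)
      (h := Fin.tail h) (w := w) (fun i => hh i.succ)
      (G := fun d => F (Fin.cons m d)) fun d => hF _)).hasSum
    refine (h3.mul_left (h 0 w ^ (g 0 + p * m))).congr_fun fun d => ?_
    simp [Fin.consEquiv, Fin.prod_univ_succ, Fin.tail, mul_assoc]
  have hstep : ∀ m, progressionSum p (Fin.tail h) (Fin.tail g) (fun d => G (Fin.cons (m + 1) d)) w =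
      progressionSum p (Fin.tail h) (Fin.tail g) (fun d => G (Fin.cons m d)) w +
      c * progressionSum p (Fin.tail h) (Fin.tail g) (fun d => H (Fin.cons m d)) w := fun m => by
    have hs : ∀ F : (Fin (r + 1) → ℕ) → K, (∀ d, ‖F d‖ ≤ 1) → Summable fun d : Fin r → ℕ =>
        (∏ i, Fin.tail h i w ^ (Fin.tail g i + p * d i)) * F (Fin.cons m d) := fun F hF =>
      summable_of_cofinite (tendsto_progressionSum hp0 (Fin.tail g)
        (h := Fin.tail h) (w := w) (fun i => hh i.succ)
        (G := fun d => F (Fin.cons m d)) fun d => hF _)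
    rw [progressionSum, progressionSum, progressionSum, ← tsum_mul_left,
      ← (hs G hG).tsum_add ((hs H hH).mul_left c)]
    refine tsum_congr fun d => ?_
    rw [hGH]
    ring
  have hSG := hfib G hG
  have hSH := hfib H hH
  have hsplit := hSG.summable.tsum_eq_zero_add
  rw [hSG.tsum_eq] at hsplit
  -- The slices `m ≥ 1` of the sum for `G`, rewritten through the slices at `m - 1`.
  have hshift : HasSum (fun m : ℕ => h 0 w ^ (g 0 + p * (m + 1)) *
      progressionSum p (Fin.tail h) (Fin.tail g) (fun d => G (Fin.cons (m + 1) d)) w)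
      (h 0 w ^ p * (progressionSum p h g G w + c * progressionSum p h g H w)) := by
    refine ((hSG.add (hSH.mul_left c)).mul_left (h 0 w ^ p)).congr_fun fun m => ?_
    rw [hstep]
    ring
  rw [hshift.tsum_eq] at hsplit
  simp only [mul_zero, add_zero] at hsplit
  linear_combination hsplit

/-- Each division by `1 - h i ^ p` costs a factor `τ`, hence `τ ^ r`. The slice `m = 0` is handled
by induction on `r`, and the difference term by recursion over all weights of the ring at once. -/
theorem IsNullClosed.progressionSum_mem {D : Type*} {A : Subring (D → K)} (hA : IsNullClosed A)
    {p : ℕ} (hp0 : 0 < p) {τ : K} (hτ : ‖τ‖ ≤ 1) (hpτ : ‖(p : K)‖ < ‖τ‖) {r : ℕ}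
    {h : Fin r → D → K} (hh : ∀ i w, ‖h i w‖ < 1)
    (hker : ∀ i, ∀ m ≤ p, (fun w => τ * (h i w ^ m * (1 - h i w ^ p)⁻¹)) ∈ A)
    {g : Fin r → ℕ} (hg : ∀ i, g i ≤ p) {G : (Fin r → ℕ) → K} (hG : G ∈ invLinearRing K p r) :
    (fun w => τ ^ r * progressionSum p h g G w) ∈ A := by
  have hp1 : ‖(p : K)‖ < 1 := hpτ.trans_le hτ
  induction r with
  | zero =>
    convert hA.const_mem (norm_le_one_of_mem_invLinearRing hp1 hG default) using 2
    simp only [progressionSum, Finset.univ_eq_empty, Finset.prod_empty, one_mul, pow_zero]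
    exact (hasSum_unique G).tsum_eq.trans (congrArg G (Subsingleton.elim _ _))
  | succ r ih =>
    have hτ0 : τ ≠ 0 := norm_pos_iff.1 ((norm_nonneg _).trans_lt hpτ)
    have ht : ‖(p : K) / τ‖ < 1 := by
      rw [norm_div, div_lt_one (norm_pos_iff.2 hτ0)]
      exact hpτ
    -- The multiplier of the recursion is `p * h ^ p / (1 - h ^ p)`, split as `p / τ` times the
    -- kernel with exponent exactly `p`; it is contracting because `‖p‖ < ‖τ‖`.
    refine hA.subset_of_recursion (X := {x | ∃ G ∈ invLinearRing K p (r + 1),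
      x = fun w => τ ^ (r + 1) * progressionSum p h g G w}) ?_ ht (hker 0 p le_rfl) ?_ _
      ⟨G, hG, rfl⟩
    · rintro x ⟨F, hF, rfl⟩ w
      rw [norm_mul, norm_pow]
      exact mul_le_one₀ (pow_le_one₀ (norm_nonneg _) hτ) (norm_nonneg _)
        (norm_progressionSum_le_one g (fun i => hh i w)
          (norm_le_one_of_mem_invLinearRing hp1 hF))
    · rintro x ⟨F, hF, rfl⟩
      obtain ⟨H, hH, hFH⟩ := exists_fwdDiff_eq_of_mem_invLinearRing hp1 hF
      refine ⟨_, ⟨H, hH, rfl⟩, _, A.mul_mem (hker 0 (g 0) (hg 0))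
        (ih (h := Fin.tail h) (fun i w => hh i.succ w) (fun i => hker i.succ)
          (g := Fin.tail g) (fun i => hg i.succ) (cons_zero_mem_invLinearRing hF)), fun w => ?_⟩
      have hrec := progressionSum_succ hp0 g (fun i => hh i w)
        (norm_le_one_of_mem_invLinearRing hp1 hF) (norm_le_one_of_mem_invLinearRing hp1 hH) hFH
      have hq : 1 - h 0 w ^ p ≠ 0 := fun h0 => by
        rw [sub_eq_zero] at h0
        have : ‖h 0 w ^ p‖ < 1 := by
          rw [norm_pow]
          exact pow_lt_one₀ (norm_nonneg _) (hh 0 w) hp0.ne'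
        rw [← h0, norm_one] at this
        exact lt_irrefl _ this
      simp only [Pi.mul_apply]
      rw [← mul_right_inj' hq, mul_left_comm, hrec]
      field_simp
      ring

end Sums

end PowerSums

/-! ### The ring of overconvergent polar expansions on the open unit disc. -/

section PolarRing

variable {K : Type*} [NormedField K] [IsUltrametricDist K]

theorem norm_sub_eq_right_of_norm_lt {x y : K} (h : ‖x‖ < ‖y‖) : ‖x - y‖ = ‖y‖ := by
  rw [sub_eq_add_neg, IsUltrametricDist.norm_add_eq_max_of_norm_ne_norm (by simpa using h.ne),
    norm_neg, max_eq_right h.le]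

/-- The powers of the polar functions `γ / (w - β i)` on the open unit disc. -/
def polarBasis {N : ℕ} (β : Fin N → K) (γ : K) (q : Fin N × ℕ) (w : {w : K // ‖w‖ < 1}) : K :=
  (γ / (w - β q.1)) ^ q.2

theorem norm_polarBasis_le_one {N : ℕ} {β : Fin N → K} (hβ : ∀ i, ‖β i‖ = 1) {γ : K}
    (hγ : ‖γ‖ ≤ 1) (q : Fin N × ℕ) (w : {w : K // ‖w‖ < 1}) : ‖polarBasis β γ q w‖ ≤ 1 := by
  rw [polarBasis, norm_pow, norm_div, norm_sub_eq_right_of_norm_lt (by rw [hβ]; exact w.2), hβ,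
    div_one]
  exact pow_le_one₀ (norm_nonneg _) hγ

variable [CompleteSpace K]

omit [IsUltrametricDist K] [CompleteSpace K] in
theorem one_mem_nullSums_polarBasis {N : ℕ} [NeZero N] (β : Fin N → K) (γ : K) :
    1 ∈ nullSums (polarBasis β γ) := by
  convert mem_nullSums_basis (e := polarBasis β γ) ((0 : Fin N), 0) using 1
  funext w
  simp [polarBasis]

/-- Partial fractions, by a double induction on the exponents. For distinct centres the constant `γ
/ (β i - β j)` is integral because the centres are at distance `1`; equal centres are allowed, since
several poles may reduce to the same point. -/
theorem polarBasis_mul_mem {N : ℕ} {β : Fin N → K} (hβ : ∀ i, ‖β i‖ = 1)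
    (hββ : ∀ i j, β i = β j ∨ ‖β i - β j‖ = 1) {γ : K} (hγ : ‖γ‖ ≤ 1) (q q' : Fin N × ℕ) :
    polarBasis β γ q * polarBasis β γ q' ∈ nullSums (polarBasis β γ) := by
  obtain ⟨i, a⟩ := q
  obtain ⟨j, b⟩ := q'
  rcases hββ i j with hij | hij
  · convert mem_nullSums_basis (e := polarBasis β γ) (i, a + b) using 1
    funext w
    simp [polarBasis, hij, pow_add]
  induction a generalizing b with
  | zero =>
    convert mem_nullSums_basis (e := polarBasis β γ) (j, b) using 1
    funext w
    simp [polarBasis]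
  | succ a iha =>
    induction b with
    | zero =>
      convert mem_nullSums_basis (e := polarBasis β γ) (i, a + 1) using 1
      funext w
      simp [polarBasis]
    | succ b ihb =>
      have hne : β i - β j ≠ 0 := norm_pos_iff.1 (hij ▸ zero_lt_one)
      have hκ : ‖γ / (β i - β j)‖ ≤ 1 := by rwa [norm_div, hij, div_one]
      refine mem_nullSums_of_hasSum (norm_polarBasis_le_one hβ hγ) (J := Fin 2)
        (x := ![γ / (β i - β j), -(γ / (β i - β j))]) ?_
        (by rw [cofinite_eq_bot]; exact tendsto_bot)
        (a := ![polarBasis β γ (i, a + 1) * polarBasis β γ (j, b),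
          polarBasis β γ (i, a) * polarBasis β γ (j, b + 1)]) ?_ fun w => ?_
      · intro k
        fin_cases k
        · exact hκ
        · simpa using hκ
      · intro k
        fin_cases k
        · exact ihb
        · exact iha (b + 1)
      · have hs := hasSum_fintype fun k : Fin 2 => (![γ / (β i - β j), -(γ / (β i - β j))] k) *
          (![polarBasis β γ (i, a + 1) * polarBasis β γ (j, b),
            polarBasis β γ (i, a) * polarBasis β γ (j, b + 1)] k) w
        convert hs using 1
        have hw : ∀ k, (w : K) - β k ≠ 0 := fun k => norm_pos_iff.1 (by
          rw [norm_sub_eq_right_of_norm_lt (by rw [hβ]; exact w.2), hβ]; exact zero_lt_one)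
        have key : γ / (w - β i) * (γ / (w - β j)) =
            γ / (β i - β j) * (γ / (w - β i) - γ / (w - β j)) := by
          have h1 := hw i
          have h2 := hw j
          field_simp
          ring
        simp only [Fin.sum_univ_two, Matrix.cons_val_zero, Matrix.cons_val_one, Pi.mul_apply,
          polarBasis]
        linear_combination (γ / (w - β i)) ^ a * (γ / (w - β j)) ^ b * key

/-- The ring of the integral power series in the `γ / (w - β i)`, as functions on the open unit
disc. -/
def polarRing {N : ℕ} [NeZero N] (β : Fin N → K) (hβ : ∀ i, ‖β i‖ = 1)
    (hββ : ∀ i j, β i = β j ∨ ‖β i - β j‖ = 1) (γ : K) (hγ : ‖γ‖ ≤ 1) :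
    Subring ({w : K // ‖w‖ < 1} → K) :=
  nullSumRing (polarBasis β γ) (norm_polarBasis_le_one hβ hγ) (one_mem_nullSums_polarBasis β γ)
    (polarBasis_mul_mem hβ hββ hγ)

theorem isNullClosed_polarRing {N : ℕ} [NeZero N] (β : Fin N → K) (hβ : ∀ i, ‖β i‖ = 1)
    (hββ : ∀ i j, β i = β j ∨ ‖β i - β j‖ = 1) (γ : K) (hγ : ‖γ‖ ≤ 1) :
    IsNullClosed (polarRing β hβ hββ γ hγ) :=
  isNullClosed_nullSumRing _ _ _ _

/-- The pole `η⁻¹` is moved to the centre `β i` by expanding `(1 - (η⁻¹ - β i) / (w - β i))⁻¹` as a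
geometric series in `(η⁻¹ - β i) / γ`, which has norm less than `1`. -/
theorem mul_inv_one_sub_mem_polarRing {N : ℕ} [NeZero N] {β : Fin N → K} (hβ : ∀ i, ‖β i‖ = 1)
    (hββ : ∀ i j, β i = β j ∨ ‖β i - β j‖ = 1) {γ : K} (hγ : ‖γ‖ ≤ 1) {η : K} (hη : ‖η‖ = 1)
    {i : Fin N} (hi : ‖η⁻¹ - β i‖ < ‖γ‖) :
    (fun w : {w : K // ‖w‖ < 1} => γ * (1 - η * w)⁻¹) ∈ polarRing β hβ hββ γ hγ := by
  have hA := isNullClosed_polarRing β hβ hββ γ hγ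
  have hγ0 : γ ≠ 0 := norm_pos_iff.1 ((norm_nonneg _).trans_lt hi)
  have he : polarBasis β γ (i, 1) ∈ polarRing β hβ hββ γ hγ := mem_nullSums_basis (i, 1)
  have ht : ‖(η⁻¹ - β i) / γ‖ < 1 := by
    rwa [norm_div, div_lt_one (norm_pos_iff.2 hγ0)]
  have hη1 : ‖-η⁻¹‖ ≤ 1 := by simp [hη]
  have hmem := hA.smul_mem _ hη1 _ (Subring.mul_mem _ he (hA.inv_one_sub_mem ht he))
  convert hmem using 1
  funext w
  have hη0 : η ≠ 0 := norm_pos_iff.1 (hη ▸ zero_lt_one)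
  have hw : (w : K) - β i ≠ 0 := norm_pos_iff.1 (by
    rw [norm_sub_eq_right_of_norm_lt (by rw [hβ]; exact w.2), hβ]; exact zero_lt_one)
  have hw' : 1 - η * (w : K) ≠ 0 := fun h0 => by
    rw [sub_eq_zero] at h0
    have := congrArg norm h0
    rw [norm_mul, hη, one_mul, norm_one] at this
    exact w.2.ne this.symm
  have hw'' : 1 - (η⁻¹ - β i) / γ * (γ / (w - β i)) ≠ 0 := by
    have : 1 - (η⁻¹ - β i) / γ * (γ / (w - β i)) = -η⁻¹ * (1 - η * w) / (w - β i) := by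
      field_simp
      ring
    rw [this]
    exact div_ne_zero (mul_ne_zero (neg_ne_zero.2 (inv_ne_zero hη0)) hw') hw
  simp only [Pi.mul_apply, polarBasis, pow_one]
  rw [← div_eq_mul_inv, ← div_eq_mul_inv, mul_div_assoc', div_eq_div_iff hw' hw'']
  field_simp
  ring

theorem pow_mul_progressionSum_mem_polarRing {N : ℕ} [NeZero N] {β : Fin N → K}
    (hβ : ∀ i, ‖β i‖ = 1) (hββ : ∀ i j, β i = β j ∨ ‖β i - β j‖ = 1) {γ : K} (hγ : ‖γ‖ ≤ 1)
    {p : ℕ} (hp : p.Prime) (hpγ : ‖(p : K)‖ < ‖γ‖ ^ p) {r : ℕ} {η : Fin r → K}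
    (hη : ∀ i, ‖η i‖ = 1) (hηβ : ∀ i, ∃ j, ‖(η i)⁻¹ - β j‖ < ‖γ‖) {g : Fin r → ℕ}
    (hg : ∀ i, g i ≤ p) {G : (Fin r → ℕ) → K} (hG : G ∈ invLinearRing K p r) :
    (fun w => (γ ^ p) ^ r * progressionSum p (fun i (w : {w : K // ‖w‖ < 1}) => η i * w) g G w) ∈
      polarRing β hβ hββ γ hγ := by
  have hA := isNullClosed_polarRing β hβ hββ γ hγ
  have hlt : ∀ i (w : {w : K // ‖w‖ < 1}), ‖η i * w‖ < 1 := fun i w => by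
    rw [norm_mul, hη, one_mul]
    exact w.2
  refine hA.progressionSum_mem hp.pos (τ := γ ^ p) ?_ (by rwa [norm_pow]) hlt (fun i m hm => ?_)
    hg hG
  · rw [norm_pow]
    exact pow_le_one₀ (norm_nonneg _) hγ
  · obtain ⟨j, hj⟩ := hηβ i
    refine hA.pow_mul_inv_one_sub_pow_mem hp hγ hpγ (fun w h1 => ?_)
      (mul_inv_one_sub_mem_polarRing hβ hββ hγ (hη i) hj) hm
    have := hlt i w
    rw [h1, norm_one] at this
    exact lt_irrefl _ this

end PolarRing

/-! ### Reduction to the residue field and the affinoid complements of residue discs. -/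

section Reduction

variable {p : ℕ} [Fact p.Prime]

theorem mem_padicComplexInt_iff {x : ℂ_[p]} : x ∈ 𝓞_ℂ_[p] ↔ ‖x‖ ≤ 1 := by
  rw [PadicComplex.norm_eq_norm]
  exact (Valued.toNormedField.norm_le_one_iff (L := ℂ_[p])).symm

theorem norm_natCast_self : ‖(p : ℂ_[p])‖ = (p : ℝ)⁻¹ := by
  simpa using PadicComplex.norm_extends' p (p : ℚ_[p])

theorem norm_natCast_self_pos : 0 < ‖(p : ℂ_[p])‖ := by
  rw [norm_natCast_self]
  exact inv_pos.2 (Nat.cast_pos.2 (Fact.out : p.Prime).pos)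

theorem norm_natCast_self_lt_one : ‖(p : ℂ_[p])‖ < 1 := by
  rw [norm_natCast_self]
  exact inv_lt_one_of_one_lt₀ (Nat.one_lt_cast.2 (Fact.out : p.Prime).one_lt)

theorem residue_eq_residue_iff {x y : 𝓞_ℂ_[p]} :
    IsLocalRing.residue (𝓞_ℂ_[p]) x = IsLocalRing.residue (𝓞_ℂ_[p]) y ↔
      ‖(x : ℂ_[p]) - y‖ < 1 := by
  rw [← sub_eq_zero, ← map_sub, IsLocalRing.residue_eq_zero_iff, IsLocalRing.mem_maximalIdeal,
    mem_nonunits_iff]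
  have hz : ‖((x - y : 𝓞_ℂ_[p]) : ℂ_[p])‖ ≤ 1 := mem_padicComplexInt_iff.1 (x - y).2
  have hcoe : (x : ℂ_[p]) - y = ((x - y : 𝓞_ℂ_[p]) : ℂ_[p]) := rfl
  rw [hcoe]
  generalize x - y = z at hz
  constructor
  · intro hu
    refine lt_of_le_of_ne hz fun h1 => hu ?_
    have hz0 : (z : ℂ_[p]) ≠ 0 := norm_pos_iff.1 (h1 ▸ zero_lt_one)
    have hinv : (z : ℂ_[p])⁻¹ ∈ 𝓞_ℂ_[p] := mem_padicComplexInt_iff.2 (by simp [h1])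
    exact IsUnit.of_mul_eq_one ⟨_, hinv⟩ (Subtype.ext (mul_inv_cancel₀ hz0))
  · rintro hlt ⟨u, rfl⟩
    have h1 : ((u : 𝓞_ℂ_[p]) : ℂ_[p]) * ((u⁻¹ : (𝓞_ℂ_[p])ˣ) : 𝓞_ℂ_[p]) = 1 :=
      congrArg Subtype.val u.mul_inv
    have h2 := congrArg norm h1
    rw [norm_mul, norm_one] at h2
    have h3 := mem_padicComplexInt_iff.1 ((u⁻¹ : (𝓞_ℂ_[p])ˣ) : 𝓞_ℂ_[p]).2
    have := (mul_le_of_le_one_right (norm_nonneg ((u : 𝓞_ℂ_[p]) : ℂ_[p])) h3).trans_lt hlt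
    exact this.ne h2

/-- A section of the reduction of integers. -/
noncomputable def liftRes (s : ResField p) : ℂ_[p] :=
  (Function.surjInv (IsLocalRing.residue_surjective (R := 𝓞_ℂ_[p])) s : 𝓞_ℂ_[p])

theorem norm_liftRes_le_one (s : ResField p) : ‖liftRes s‖ ≤ 1 :=
  mem_padicComplexInt_iff.1 (Subtype.prop _)

theorem red_coe_of_norm_le_one {x : ℂ_[p]} (hx : ‖x‖ ≤ 1) : red (x : P1 p) =
    ((IsLocalRing.residue (𝓞_ℂ_[p]) ⟨x, mem_padicComplexInt_iff.2 hx⟩ : ResField p) : P1Res p) :=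
  dif_pos (mem_padicComplexInt_iff.2 hx)

theorem red_coe_of_one_lt_norm {x : ℂ_[p]} (hx : 1 < ‖x‖) : red (x : P1 p) = OnePoint.infty :=
  dif_neg fun h => hx.not_ge (mem_padicComplexInt_iff.1 h)

theorem red_infty : red (OnePoint.infty : P1 p) = OnePoint.infty := rfl

theorem red_coe_eq_coe_iff {x : ℂ_[p]} {s : ResField p} :
    red (x : P1 p) = (s : P1Res p) ↔ ‖x - liftRes s‖ < 1 := by
  rcases le_or_gt ‖x‖ 1 with hx | hx
  · rw [red_coe_of_norm_le_one hx, OnePoint.coe_eq_coe]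
    have hs := Function.surjInv_eq (IsLocalRing.residue_surjective (R := 𝓞_ℂ_[p])) s
    conv_lhs => rw [← hs]
    exact residue_eq_residue_iff
  · rw [red_coe_of_one_lt_norm hx]
    refine iff_of_false (OnePoint.infty_ne_coe _) ?_
    rw [← norm_neg, neg_sub, norm_sub_eq_right_of_norm_lt ((norm_liftRes_le_one s).trans_lt hx)]
    exact hx.le.not_gt

theorem red_liftRes (s : ResField p) : red (liftRes s : P1 p) = (s : P1Res p) :=
  red_coe_eq_coe_iff.2 (by simp)

/-- A fixed section gives points with equal residue the same lift, so this is precisely the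
dichotomy that partial fractions need. -/
theorem liftRes_eq_or_norm_sub_eq_one (s t : ResField p) :
    liftRes s = liftRes t ∨ ‖liftRes s - liftRes t‖ = 1 := by
  by_cases h : ‖liftRes s - liftRes t‖ < 1
  · refine Or.inl ?_
    have := red_coe_eq_coe_iff.2 h
    rw [red_liftRes, OnePoint.coe_eq_coe] at this
    rw [this]
  · refine Or.inr (le_antisymm ?_ (not_lt.1 h))
    rw [sub_eq_add_neg]
    refine (IsUltrametricDist.norm_add_le_max _ _).trans (max_le (norm_liftRes_le_one s) ?_)
    rw [norm_neg]
    exact norm_liftRes_le_one t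

theorem mem_affinoid_zero_coe {N : ℕ} {α : Fin N → ℂ_[p]} {δ : Fin N → ℝ} {w : ℂ_[p]} :
    (w : P1 p) ∈ affinoid α δ 0 ↔ ∀ i, δ i ≤ ‖w - α i‖ := by
  simp [affinoid]

theorem infty_mem_affinoid_zero {N : ℕ} {α : Fin N → ℂ_[p]} {δ : Fin N → ℝ} :
    (OnePoint.infty : P1 p) ∈ affinoid α δ 0 := by
  simp [affinoid]

theorem compl_tube_range_eq_affinoid {N : ℕ} (s : Fin N → ResField p) :
    (tube (Set.range fun j => (s j : P1Res p)))ᶜ =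
      affinoid (fun j => liftRes (s j)) (fun _ => 1) 0 := by
  ext z
  induction z using OnePoint.rec with
  | infty => simp [tube, infty_mem_affinoid_zero, red_infty]
  | coe w =>
    rw [mem_affinoid_zero_coe]
    simp [tube, eq_comm (b := red _), red_coe_eq_coe_iff]

theorem shrunkComplement_range_eq_affinoid {N : ℕ} (s : Fin N → ResField p) (c : ℝ) :
    shrunkComplement (Set.range fun j => (s j : P1Res p)) liftRes c =
      affinoid (fun j => liftRes (s j)) (fun _ => c) 0 := by
  ext z
  induction z using OnePoint.rec with
  | infty => simp [shrunkComplement, infty_mem_affinoid_zero]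
  | coe w =>
    rw [mem_affinoid_zero_coe]
    simp [shrunkComplement]

end Reduction

/-! ### From the polar ring to rigid functions on the projective line. -/

section Expansion

variable {p : ℕ} [Fact p.Prime]

/-- The function on the projective line with value `a` at infinity and principal parts
`∑_m b_{i,m} / (z - α_i) ^ (m + 1)`. -/
noncomputable def polarExpansion {N : ℕ} (α : Fin N → ℂ_[p]) (a : ℂ_[p]) (b : Fin N → ℕ → ℂ_[p])
    (z : P1 p) : ℂ_[p] :=
  z.elim a fun w => a + ∑ i, ∑' m, b i m / (w - α i) ^ (m + 1)

theorem isRigidAnalyticOn_polarExpansion {N : ℕ} {α : Fin N → ℂ_[p]} {δ : Fin N → ℝ}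
    (hδ : ∀ i, 0 < δ i) (a : ℂ_[p]) {b : Fin N → ℕ → ℂ_[p]}
    (hb : ∀ i, Tendsto (fun m : ℕ => ‖b i m‖ * (1 / δ i) ^ (m + 1)) atTop (𝓝 0)) :
    IsRigidAnalyticOn (affinoid α δ 0) (polarExpansion α a b) := by
  refine ⟨N, α, δ, 0, Pi.single 0 a, b, hδ, le_rfl, rfl, fun _ m hm => ?_,
    fun h => absurd h (lt_irrefl _), hb, fun w _ => ?_, fun _ => ?_⟩
  · exact Pi.single_eq_of_ne (by omega) _
  · rw [tsum_eq_single 0 fun m hm => by simp [hm]]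
    simp [polarExpansion]
  · simp [polarExpansion]

theorem exists_polarExpansion_of_mem_polarRing {N : ℕ} [NeZero N] {β : Fin N → ℂ_[p]}
    (hβ : ∀ i, ‖β i‖ = 1) (hββ : ∀ i j, β i = β j ∨ ‖β i - β j‖ = 1) {γ : ℂ_[p]} (hγ0 : γ ≠ 0)
    (hγ : ‖γ‖ ≤ 1) {c : ℂ_[p]} (hc : c ≠ 0) {f : {w : ℂ_[p] // ‖w‖ < 1} → ℂ_[p]}
    (hf : (fun w => c * f w) ∈ polarRing β hβ hββ γ hγ) :
    ∃ (a : ℂ_[p]) (b : Fin N → ℕ → ℂ_[p]),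
      (∀ i, Tendsto (fun m : ℕ => ‖b i m‖ * (1 / ‖γ‖) ^ (m + 1)) atTop (𝓝 0)) ∧
      ∀ w : {w : ℂ_[p] // ‖w‖ < 1}, polarExpansion β a b (w : ℂ_[p]) = f w := by
  obtain ⟨b, -, hb0, hbs⟩ := hf
  -- Every centre contributes its own constant term, with exponent `0`; together they form the value
  -- at infinity. The factor `γ ^ (m + 1)` gives the decay for radius `‖γ‖`.
  refine ⟨c⁻¹ * ∑ i, b (i, 0), fun i m => c⁻¹ * (b (i, m + 1) * γ ^ (m + 1)), fun i => ?_,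
    fun w => ?_⟩
  · have h1 : Tendsto (fun m : ℕ => b (i, m + 1)) atTop (𝓝 0) := by
      rw [← Nat.cofinite_eq_atTop]
      refine hb0.comp (Function.Injective.tendsto_cofinite fun m n hmn => ?_)
      simpa using hmn
    have h2 := (h1.const_mul c⁻¹).norm
    rw [mul_zero, norm_zero] at h2
    refine h2.congr fun m => ?_
    have : ‖γ‖ ≠ 0 := norm_ne_zero_iff.2 hγ0
    rw [norm_mul, norm_mul, norm_mul, norm_pow, one_div, inv_pow]
    field_simp
  · have hs : HasSum _ (c * f w) := hbs w
    have hfac : ∀ i, Summable fun m => b (i, m) * polarBasis β γ (i, m) w := fun i =>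
      hs.summable.prod_factor i
    have h1 : c * f w = ∑ i, (b (i, 0) + ∑' m, b (i, m + 1) * (γ / (w - β i)) ^ (m + 1)) := by
      rw [← hs.tsum_eq, hs.summable.tsum_prod, tsum_fintype]
      refine Finset.sum_congr rfl fun i _ => ?_
      rw [(hfac i).tsum_eq_zero_add]
      simp [polarBasis]
    have h2 : f w = c⁻¹ * (c * f w) := by rw [inv_mul_cancel_left₀ hc]
    rw [h2, h1, Finset.sum_add_distrib, mul_add]
    simp only [polarExpansion, OnePoint.elim_some]
    congr 1
    rw [Finset.mul_sum]
    refine Finset.sum_congr rfl fun i _ => ?_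
    rw [← tsum_mul_left]
    refine tsum_congr fun m => ?_
    rw [div_pow]
    ring

end Expansion

/-! ### Increasing sequences with prescribed residues, parametrised by their gaps. -/

section Progressions

theorem sum_Iic_zero {r : ℕ} (f : Fin (r + 1) → ℕ) : ∑ i ∈ Finset.Iic 0, f i = f 0 := by
  rw [show (Finset.Iic 0 : Finset (Fin (r + 1))) = {0} by ext i; simp]
  simp

theorem sum_Iic_succ {r : ℕ} (f : Fin (r + 1) → ℕ) (j : Fin r) :
    ∑ i ∈ Finset.Iic j.succ, f i = ∑ i ∈ Finset.Iic j.castSucc, f i + f j.succ := by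
  have h : Finset.Iic j.succ = insert j.succ (Finset.Iic j.castSucc) := by
    ext i
    simp only [Finset.mem_Iic, Finset.mem_insert, Fin.le_def, Fin.ext_iff, Fin.val_succ,
      Fin.val_castSucc]
    omega
  rw [h, Finset.sum_insert (by simp [Fin.le_def]), add_comm]

theorem exists_add_modEq {p : ℕ} (hp : 0 < p) (a b : ℕ) :
    ∃ g, 0 < g ∧ g ≤ p ∧ a + g ≡ b [MOD p] := by
  -- In natural numbers `(p - 1) * a` plays the role of `-a`, and the shift by one puts the
  -- representative in `[1, p]`, as a gap must be positive.
  refine ⟨(b + (p - 1) * a + (p - 1)) % p + 1, Nat.succ_pos _, Nat.mod_lt _ hp, ?_⟩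
  have h1 : a + ((b + (p - 1) * a + (p - 1)) % p + 1) ≡
      a + (b + (p - 1) * a + (p - 1) + 1) [MOD p] :=
    ((Nat.mod_modEq _ _).add_right 1).add_left a
  refine h1.trans ?_
  obtain ⟨q, rfl⟩ : ∃ q, p = q + 1 := ⟨p - 1, by omega⟩
  have h2 : a + (b + (q + 1 - 1) * a + (q + 1 - 1) + 1) = b + (q + 1) * (a + 1) := by
    simp only [Nat.add_sub_cancel]
    ring
  rw [h2]
  exact Nat.modEq_iff_dvd.2 ⟨-((a : ℤ) + 1), by push_cast; ring⟩

theorem exists_eq_add_mul_of_modEq {p h g : ℕ} (hh : 0 < h) (hg : g ≤ p)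
    (hhg : h ≡ g [MOD p]) : ∃ d, h = g + p * d := by
  have hle : g ≤ h := by
    by_contra! hlt
    have h1 := Nat.le_of_dvd (by omega) ((Nat.modEq_iff_dvd' hlt.le).1 hhg)
    omega
  obtain ⟨d, hd⟩ := (Nat.modEq_iff_dvd' hle).1 hhg.symm
  exact ⟨d, by omega⟩

/-- `g` are gaps in `[1, p]` of an increasing sequence with residues `α` modulo `p`. -/
structure IsGapSequence (p : ℕ) {r : ℕ} (α g : Fin (r + 1) → ℕ) : Prop where
  pos : ∀ j, 0 < g j
  le : ∀ j, g j ≤ p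
  zero : g 0 = α 0
  succ : ∀ j : Fin r, α j.castSucc + g j.succ ≡ α j.succ [MOD p]

theorem exists_isGapSequence {p r : ℕ} {α : Fin (r + 1) → ℕ} (hα : ∀ j, 0 < α j ∧ α j < p) :
    ∃ g, IsGapSequence p α g := by
  choose f hf using fun j : Fin r =>
    exists_add_modEq ((Nat.zero_le _).trans_lt (hα 0).2) (α j.castSucc) (α j.succ)
  refine ⟨Fin.cons (α 0) f, fun j => ?_, fun j => ?_, rfl, fun j => by simpa using (hf j).2.2⟩
  · refine Fin.cases ?_ (fun j => ?_) j
    · exact (hα 0).1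
    · exact (hf j).1
  · refine Fin.cases ?_ (fun j => ?_) j
    · exact (hα 0).2.le
    · exact (hf j).2.1

/-- The increasing sequence with gaps `g i + p * d i`. -/
def gapSums (p : ℕ) {r : ℕ} (g d : Fin (r + 1) → ℕ) (j : Fin (r + 1)) : ℕ :=
  ∑ i ∈ Finset.Iic j, (g i + p * d i)

variable {p r : ℕ} {α g : Fin (r + 1) → ℕ}

theorem gapSums_zero (d : Fin (r + 1) → ℕ) : gapSums p g d 0 = g 0 + p * d 0 :=
  sum_Iic_zero _

theorem gapSums_succ (d : Fin (r + 1) → ℕ) (j : Fin r) :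
    gapSums p g d j.succ = gapSums p g d j.castSucc + (g j.succ + p * d j.succ) :=
  sum_Iic_succ _ _

theorem gapSums_injective (hp : 0 < p) :
    Function.Injective (gapSums p g : (Fin (r + 1) → ℕ) → Fin (r + 1) → ℕ) := by
  intro d d' hdd
  funext j
  refine Nat.eq_of_mul_eq_mul_left hp ?_
  refine Fin.cases ?_ (fun j => ?_) j
  · have := congrFun hdd 0
    rw [gapSums_zero, gapSums_zero] at this
    omega
  · have h1 := congrFun hdd j.succ
    have h2 := congrFun hdd j.castSucc
    rw [gapSums_succ, gapSums_succ] at h1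
    omega

theorem IsGapSequence.gapSums_modEq (hg : IsGapSequence p α g) (d : Fin (r + 1) → ℕ)
    (j : Fin (r + 1)) : gapSums p g d j ≡ α j [MOD p] := by
  have hmul : ∀ a m : ℕ, a + p * m ≡ a [MOD p] := fun a m =>
    Nat.modEq_iff_dvd.2 ⟨-(m : ℤ), by push_cast; ring⟩
  refine Fin.induction ?_ (fun j ih => ?_) j
  · rw [gapSums_zero, hg.zero]
    exact hmul _ _
  · rw [gapSums_succ, ← add_assoc]
    exact (hmul _ _).trans ((ih.add_right _).trans (hg.succ j))

theorem IsGapSequence.range_gapSums (hg : IsGapSequence p α g) :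
    Set.range (gapSums p g) = partialIndexSet p α := by
  ext k
  constructor
  · rintro ⟨d, rfl⟩
    refine ⟨?_, Fin.strictMono_iff_lt_succ.2 fun j => ?_, hg.gapSums_modEq d⟩
    · rw [gapSums_zero]
      exact Nat.add_pos_left (hg.pos 0) _
    · rw [gapSums_succ]
      have := hg.pos j.succ
      omega
  · rintro ⟨h0, hmono, hmod⟩
    obtain ⟨d0, hd0⟩ := exists_eq_add_mul_of_modEq h0 (hg.le 0) (hg.zero ▸ hmod 0)
    have hstep : ∀ j : Fin r, ∃ d, k j.succ = k j.castSucc + (g j.succ + p * d) := fun j => by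
      have hlt := Fin.strictMono_iff_lt_succ.1 hmono j
      have hmod' : k j.succ - k j.castSucc ≡ g j.succ [MOD p] := by
        refine Nat.ModEq.add_left_cancel (hmod j.castSucc) ?_
        rw [Nat.add_sub_cancel' hlt.le]
        exact (hmod j.succ).trans (hg.succ j).symm
      obtain ⟨d, hd⟩ := exists_eq_add_mul_of_modEq (Nat.sub_pos_of_lt hlt) (hg.le j.succ) hmod'
      exact ⟨d, by omega⟩
    choose d hd using hstep
    refine ⟨Fin.cons d0 d, funext fun j => ?_⟩
    refine Fin.induction ?_ (fun j ih => ?_) j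
    · rw [gapSums_zero, Fin.cons_zero, hd0]
    · rw [gapSums_succ, ih, Fin.cons_succ, hd]

theorem coprime_of_modEq {p a b : ℕ} (hp : p.Prime) (hb : 0 < b ∧ b < p) (h : a ≡ b [MOD p]) :
    a.Coprime p := by
  have hbc : b.Coprime p :=
    (hp.coprime_iff_not_dvd.2 fun h => (Nat.le_of_dvd hb.1 h).not_gt hb.2).symm
  rw [Nat.Coprime, h.gcd_eq]
  exact hbc

theorem partialIndexSet_subset (hp : p.Prime) (hα : ∀ j, 0 < α j ∧ α j < p) :
    partialIndexSet p α ⊆ indexSet p r := fun _ hk =>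
  ⟨hk.1, hk.2.1, fun j => coprime_of_modEq hp (hα j) (hk.2.2 j)⟩

theorem finite_indexSet_last_le (N : ℕ) :
    {k : Fin (r + 1) → ℕ | StrictMono k ∧ k (Fin.last r) ≤ N}.Finite :=
  (Set.finite_Iic fun _ => N).subset fun _ hk j => (hk.1.monotone (Fin.le_last j)).trans hk.2

theorem indicator_indexSet_eq_sum {M : Type*} [AddCommMonoid M] (hp : p.Prime)
    (f : (Fin (r + 1) → ℕ) → M) (k : Fin (r + 1) → ℕ) :
    (indexSet p r).indicator f k =
      ∑ α ∈ Fintype.piFinset fun _ : Fin (r + 1) => Finset.Ioo 0 p,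
        (partialIndexSet p α).indicator f k := by
  have hmem : ∀ {α : Fin (r + 1) → ℕ}, α ∈ (Fintype.piFinset fun _ : Fin (r + 1) =>
      Finset.Ioo 0 p) ↔ ∀ j, 0 < α j ∧ α j < p := by simp
  by_cases hk : k ∈ indexSet p r
  · have hα : ∀ j, 0 < k j % p ∧ k j % p < p := fun j => by
      refine ⟨Nat.pos_of_ne_zero fun h0 => ?_, Nat.mod_lt _ hp.pos⟩
      have h1 := hk.2.2 j
      rw [Nat.Coprime, Nat.gcd_eq_right (Nat.dvd_of_mod_eq_zero h0)] at h1
      exact hp.one_lt.ne' h1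
    rw [Finset.sum_eq_single_of_mem (fun j => k j % p) (hmem.2 hα), Set.indicator_of_mem hk,
      Set.indicator_of_mem (show k ∈ partialIndexSet p fun j => k j % p from
        ⟨hk.1, hk.2.1, fun j => (Nat.mod_modEq _ _).symm⟩)]
    intro α hα' hne
    refine Set.indicator_of_notMem (fun hk' => hne (funext fun j => ?_)) _
    rw [← Nat.mod_eq_of_lt (hmem.1 hα' j).2]
    exact (hk'.2.2 j).symm
  · rw [Set.indicator_of_notMem hk]
    refine (Finset.sum_eq_zero fun α hα => Set.indicator_of_notMem (fun hk' => hk ?_) _).symm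
    exact partialIndexSet_subset hp (hmem.1 hα) hk'

/-- The weight `∏_j k_j ^ (-n_j)` in the coordinates of `gapSums`. -/
def gapWeight (K : Type*) [NormedField K] (p : ℕ) {r : ℕ} (n g d : Fin (r + 1) → ℕ) : K :=
  ∏ j, ((gapSums p g d j : K)⁻¹) ^ n j

theorem IsGapSequence.gapWeight_mem (K : Type*) [NormedField K] (hp : p.Prime)
    (n : Fin (r + 1) → ℕ) (hα : ∀ j, 0 < α j ∧ α j < p)
    (hg : IsGapSequence p α g) : gapWeight K p n g ∈ invLinearRing K p (r + 1) := by
  have hmem : ∀ j, (fun d => (gapSums p g d j : K)⁻¹) ∈ invLinearRing K p (r + 1) :=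
    fun j => by
    -- A gap sum is its value at `d = 0`, which is prime to `p`, plus `p` times the sum of the `d i`
    -- with `i ≤ j`.
    refine Subring.subset_closure ⟨gapSums p g 0 j, fun i => if i ≤ j then 1 else 0,
      coprime_of_modEq hp (hα j) (hg.gapSums_modEq 0 j), ?_⟩
    funext d
    congr 2
    simp only [gapSums, Finset.sum_add_distrib, Finset.mul_sum, Pi.zero_apply, mul_zero, add_zero,
      ite_mul, one_mul, zero_mul, mul_ite]
    rw [← Finset.sum_filter]
    congr 2
    ext i
    simp
  have hprod : gapWeight K p n g =
      ∏ j, (fun d => (gapSums p g d j : K)⁻¹) ^ n j := by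
    funext d
    simp only [gapWeight, Finset.prod_apply, Pi.pow_apply]
  rw [hprod]
  exact Subring.prod_mem _ fun j _ => Subring.pow_mem _ (hmem j) (n j)

end Progressions

/-! ### The polylogarithm series in gap coordinates. -/

section Series

variable {p : ℕ} [Fact p.Prime] {r : ℕ} {n : Fin (r + 1) → ℕ} {ξ : Fin (r + 1) → ℂ_[p]}

theorem norm_term_le (hξ : ∀ j, ‖ξ j‖ = 1) {k : Fin (r + 1) → ℕ} (hk : k ∈ indexSet p r)
    (z : ℂ_[p]) : ‖term n ξ z k‖ ≤ ‖z‖ ^ k (Fin.last r) := by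
  have h1 : ‖∏ j, ξ j ^ k j‖ = 1 := by simp [norm_prod, hξ]
  have h2 : ‖∏ j, (k j : ℂ_[p]) ^ n j‖ = 1 := by
    simp [norm_prod, norm_natCast_eq_one_of_coprime norm_natCast_self_lt_one (hk.2.2 _)]
  rw [term, norm_mul, norm_div, h1, h2, norm_pow, div_one, one_mul]

theorem summable_term (hξ : ∀ j, ‖ξ j‖ = 1) {s : Set (Fin (r + 1) → ℕ)} (hs : s ⊆ indexSet p r)
    {z : ℂ_[p]} (hz : ‖z‖ < 1) : Summable fun k : s => term n ξ z k := by
  refine summable_of_cofinite (tendsto_zero_of_norm_le_pow (norm_nonneg z) hz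
    (fun k => k.1 (Fin.last r)) (fun N => ?_) fun k => norm_term_le hξ (hs k.2) z)
  refine ((finite_indexSet_last_le N).preimage Subtype.val_injective.injOn).subset fun k hk => ?_
  exact ⟨(hs k.2).2.1, hk⟩

theorem rigidTMPL_eq_sum (hξ : ∀ j, ‖ξ j‖ = 1) {z : ℂ_[p]} (hz : ‖z‖ < 1) :
    rigidTMPL n ξ z = ∑ α ∈ Fintype.piFinset fun _ : Fin (r + 1) => Finset.Ioo 0 p,
      partialTMPL α n ξ z := by
  have hp : p.Prime := Fact.out
  simp only [rigidTMPL, partialTMPL]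
  rw [tsum_subtype (indexSet p r) (term n ξ z)]
  simp_rw [fun α : Fin (r + 1) → ℕ => tsum_subtype (partialIndexSet p α) (term n ξ z)]
  rw [← Summable.tsum_finsetSum]
  · exact tsum_congr fun k => indicator_indexSet_eq_sum hp _ k
  · intro α hα
    refine summable_subtype_iff_indicator.1 (summable_term hξ (partialIndexSet_subset hp ?_) hz)
    simpa using hα

/-- The products `ξ_j ξ_{j+1} ⋯ ξ_r`. -/
noncomputable def tailProd (ξ : Fin (r + 1) → ℂ_[p]) (j : Fin (r + 1)) : ℂ_[p] :=
  ∏ i ∈ Finset.Ici j, ξ i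

theorem norm_tailProd (hξ : ∀ j, ‖ξ j‖ = 1) (j : Fin (r + 1)) : ‖tailProd ξ j‖ = 1 := by
  simp [tailProd, norm_prod, hξ]

/-- The gap with index `i` occurs in every `k_j` with `j ≥ i`, so it is the exponent of `∏_{j ≥ i}
ξ_j`, and it occurs once in the exponent of `z`. This is why the poles lie at the inverses of the
tail products. -/
theorem term_gapSums (g d : Fin (r + 1) → ℕ) (z : ℂ_[p]) :
    term n ξ z (gapSums p g d) =
      (∏ i, (tailProd ξ i * z) ^ (g i + p * d i)) * gapWeight ℂ_[p] p n g d := by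
  have h1 : ∏ j, ξ j ^ gapSums p g d j = ∏ i, tailProd ξ i ^ (g i + p * d i) := by
    simp only [gapSums, tailProd, ← Finset.prod_pow_eq_pow_sum, ← Finset.prod_pow]
    exact Finset.prod_comm' (by simp)
  have h2 : z ^ gapSums p g d (Fin.last r) = ∏ i, z ^ (g i + p * d i) := by
    rw [gapSums, Finset.prod_pow_eq_pow_sum]
    congr 2
    ext i
    simp [Fin.le_last]
  have h3 : gapWeight ℂ_[p] p n g d = (∏ j, (gapSums p g d j : ℂ_[p]) ^ n j)⁻¹ := by
    simp [gapWeight]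
  rw [term, h1, h2, h3, div_eq_mul_inv, mul_right_comm, ← Finset.prod_mul_distrib]
  simp_rw [mul_pow]

theorem partialTMPL_eq_tsum_gapSums {α g : Fin (r + 1) → ℕ} (hg : IsGapSequence p α g)
    (z : ℂ_[p]) : partialTMPL α n ξ z = ∑' d, term n ξ z (gapSums p g d) := by
  have hp : p.Prime := Fact.out
  rw [partialTMPL, ← hg.range_gapSums, tsum_range _ (gapSums_injective hp.pos)]

theorem partialTMPL_eq_progressionSum {α g : Fin (r + 1) → ℕ} (hg : IsGapSequence p α g)
    (z : {w : ℂ_[p] // ‖w‖ < 1}) :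
    partialTMPL α n ξ z = progressionSum p (fun i (w : {w : ℂ_[p] // ‖w‖ < 1}) =>
      tailProd ξ i * (w : ℂ_[p])) g (gapWeight ℂ_[p] p n g) z := by
  rw [partialTMPL_eq_tsum_gapSums hg]
  simp_rw [term_gapSums]
  rfl

end Series

/-! ### The identity principle, by rational approximation and the Gauss norm. -/

section Uniqueness

open Polynomial

variable {K : Type*} [NormedField K] [IsUltrametricDist K]

theorem norm_sum_lt_of_forall_lt {ι : Type*} {s : Finset ι} {f : ι → K} {C : ℝ} (hC : 0 < C)
    (h : ∀ i ∈ s, ‖f i‖ < C) : ‖∑ i ∈ s, f i‖ < C :=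
  Finset.sum_induction f (fun x => ‖x‖ < C)
    (fun _ _ hx hy => (IsUltrametricDist.norm_add_le_max _ _).trans_lt (max_lt hx hy))
    (by simpa using hC) h

/-- A polynomial bounded by `ε` on the open unit disc has coefficients bounded by `ε`, if the norm
takes values arbitrarily close to `1`. -/
theorem norm_coeff_le_of_norm_eval_le (hK : ∀ s < (1 : ℝ), ∃ w : K, s < ‖w‖ ∧ ‖w‖ < 1) {P : K[X]}
    {ε : ℝ} (hP : ∀ w : K, ‖w‖ < 1 → ‖P.eval w‖ ≤ ε) (k : ℕ) : ‖P.coeff k‖ ≤ ε := by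
  by_contra! hk
  have hε : 0 ≤ ε := (norm_nonneg _).trans (hP 0 (by simp))
  classical
  obtain ⟨k₀, hk₀⟩ : ∃ k₀, ∀ i, ‖P.coeff i‖ ≤ ‖P.coeff k₀‖ := by
    obtain ⟨k₀, -, h⟩ := Finset.exists_max_image (Finset.range (P.natDegree + 1))
      (fun i => ‖P.coeff i‖) ⟨0, by simp⟩
    refine ⟨k₀, fun i => ?_⟩
    rcases lt_or_ge i (P.natDegree + 1) with hi | hi
    · exact h i (Finset.mem_range.2 hi)
    · rw [coeff_eq_zero_of_natDegree_lt hi, norm_zero]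
      exact norm_nonneg _
  have hex : ∃ l, ‖P.coeff k₀‖ ≤ ‖P.coeff l‖ := ⟨k₀, le_rfl⟩
  -- The smallest index with a coefficient of maximal norm. For `‖w‖` below but near `1` its term
  -- dominates strictly: lower coefficients are strictly smaller, and higher powers of `w` are
  -- strictly smaller.
  set l := Nat.find hex with hl
  have hmax : ∀ i, ‖P.coeff i‖ ≤ ‖P.coeff l‖ := fun i => (hk₀ i).trans (Nat.find_spec hex)
  have hmin : ∀ i < l, ‖P.coeff i‖ < ‖P.coeff l‖ := fun i hi =>
    (not_le.1 (Nat.find_min hex hi)).trans_le (Nat.find_spec hex)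
  have hlε : ε < ‖P.coeff l‖ := hk.trans_le (hmax k)
  have hlim : Tendsto (fun t : ℝ => ‖P.coeff l‖ * t ^ l) (𝓝[<] 1) (𝓝 ‖P.coeff l‖) := by
    have : Continuous fun t : ℝ => ‖P.coeff l‖ * t ^ l := by fun_prop
    simpa using (this.tendsto 1).mono_left nhdsWithin_le_nhds
  have hev : ∀ᶠ t in 𝓝[<] (1 : ℝ), ε < ‖P.coeff l‖ * t ^ l ∧
      ∀ i ∈ Finset.range l, ‖P.coeff i‖ < ‖P.coeff l‖ * t ^ l :=
    (hlim.eventually_const_lt hlε).and ((eventually_all_finset _).2 fun i hi =>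
      hlim.eventually_const_lt (hmin i (Finset.mem_range.1 hi)))
  obtain ⟨s, hs, hsub⟩ := (mem_nhdsLT_iff_exists_Ioo_subset).1 hev
  obtain ⟨w, hw0, hw1⟩ := hK (max s 0) (max_lt hs zero_lt_one)
  obtain ⟨h1, h2⟩ := hsub ⟨(le_max_left _ _).trans_lt hw0, hw1⟩
  have hwpos : 0 < ‖w‖ := (le_max_right _ _).trans_lt hw0
  have hdom : ‖∑ i ∈ (Finset.range (P.natDegree + 1)).erase l, P.coeff i * w ^ i‖ <
      ‖P.coeff l * w ^ l‖ := by
    rw [norm_mul, norm_pow]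
    refine norm_sum_lt_of_forall_lt (hε.trans_lt h1) fun i hi => ?_
    rw [norm_mul, norm_pow]
    rcases lt_or_gt_of_ne (Finset.ne_of_mem_erase hi) with hil | hil
    · exact (mul_le_of_le_one_right (norm_nonneg _) (pow_le_one₀ hwpos.le hw1.le)).trans_lt
        (h2 i (Finset.mem_range.2 hil))
    · exact (mul_le_mul_of_nonneg_right (hmax i) (by positivity)).trans_lt
        (mul_lt_mul_of_pos_left (pow_lt_pow_right_of_lt_one₀ hwpos hw1 hil) (hε.trans_lt hlε))
  have hmem : l ∈ Finset.range (P.natDegree + 1) := by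
    by_contra hcon
    have : P.coeff l = 0 := coeff_eq_zero_of_natDegree_lt (by simpa using hcon)
    rw [this, norm_zero] at hlε
    exact hε.not_gt hlε
  have heval := eval_eq_sum_range (p := P) w
  rw [← Finset.add_sum_erase _ _ hmem] at heval
  have hnorm : ‖P.eval w‖ = ‖P.coeff l * w ^ l‖ := by
    rw [heval, IsUltrametricDist.norm_add_eq_max_of_norm_ne_norm hdom.ne', max_eq_left hdom.le]
  have := hP w hw1
  rw [hnorm, norm_mul, norm_pow] at this
  exact this.not_gt h1

/-- On `U` the function `f` is a uniform limit of rational functions without pole at infinity,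
whose denominators are as large as possible on `U` and integral on the open unit disc. -/
def IsUniformLimit (U : Set (OnePoint K)) (f : OnePoint K → K) : Prop :=
  ∀ ε > 0, ∃ (P Q : K[X]) (m : ℕ), P.natDegree ≤ m ∧ Q.natDegree ≤ m ∧ Q.coeff m = 1 ∧
    (∀ w : K, ‖w‖ < 1 → ‖Q.eval w‖ ≤ 1) ∧
    (∀ w : K, (w : OnePoint K) ∈ U → max 1 ‖w‖ ^ m ≤ ‖Q.eval w‖) ∧
    (∀ w : K, (w : OnePoint K) ∈ U → ‖f (w : OnePoint K) - P.eval w / Q.eval w‖ ≤ ε) ∧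
    ‖f OnePoint.infty - P.coeff m‖ ≤ ε

omit [IsUltrametricDist K] in
theorem eval_ne_zero_of_max_pow_le {Q : K[X]} {m : ℕ} {w : K}
    (h : max 1 ‖w‖ ^ m ≤ ‖Q.eval w‖) : Q.eval w ≠ 0 :=
  norm_pos_iff.1 ((pow_pos (lt_max_of_lt_left zero_lt_one) m).trans_le h)

namespace IsUniformLimit

variable {U : Set (OnePoint K)} {f g : OnePoint K → K}

theorem add (hf : IsUniformLimit U f) (hg : IsUniformLimit U g) :
    IsUniformLimit U fun z => f z + g z := by
  intro ε hε
  obtain ⟨P, Q, m, hP, hQ, hQm, hQ1, hQX, hfX, hfi⟩ := hf ε hε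
  obtain ⟨R, T, l, hR, hT, hTl, hT1, hTX, hgX, hgi⟩ := hg ε hε
  refine ⟨P * T + Q * R, Q * T, m + l, ?_, ?_, ?_, fun w hw => ?_, fun w hw => ?_, fun w hw => ?_,
    ?_⟩
  · exact natDegree_add_le_of_degree_le (natDegree_mul_le_of_le hP hT)
      (natDegree_mul_le_of_le hQ hR)
  · exact natDegree_mul_le_of_le hQ hT
  · rw [coeff_mul_add_eq_of_natDegree_le hQ hT, hQm, hTl, one_mul]
  · rw [eval_mul, norm_mul]
    exact mul_le_one₀ (hQ1 w hw) (norm_nonneg _) (hT1 w hw)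
  · rw [eval_mul, norm_mul, pow_add]
    exact mul_le_mul (hQX w hw) (hTX w hw) (by positivity) (norm_nonneg _)
  · have h1 := eval_ne_zero_of_max_pow_le (hQX w hw)
    have h2 := eval_ne_zero_of_max_pow_le (hTX w hw)
    have : f w + g w - (P * T + Q * R).eval w / (Q * T).eval w =
        (f w - P.eval w / Q.eval w) + (g w - R.eval w / T.eval w) := by
      simp only [eval_add, eval_mul]
      field_simp
      ring
    rw [this]
    exact (IsUltrametricDist.norm_add_le_max _ _).trans (max_le (hfX w hw) (hgX w hw))
  · rw [coeff_add, coeff_mul_add_eq_of_natDegree_le hP hT, coeff_mul_add_eq_of_natDegree_le hQ hR,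
      hQm, hTl, mul_one, one_mul, add_sub_add_comm]
    exact (IsUltrametricDist.norm_add_le_max _ _).trans (max_le hfi hgi)

omit [IsUltrametricDist K] in
theorem neg (hf : IsUniformLimit U f) : IsUniformLimit U fun z => -f z := by
  intro ε hε
  obtain ⟨P, Q, m, hP, hQ, hQm, hQ1, hQX, hfX, hfi⟩ := hf ε hε
  refine ⟨-P, Q, m, by rwa [natDegree_neg], hQ, hQm, hQ1, hQX, fun w hw => ?_, ?_⟩
  · rw [eval_neg, neg_div, ← neg_sub', norm_neg]
    exact hfX w hw
  · rw [coeff_neg, ← neg_sub', norm_neg]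
    exact hfi

omit [IsUltrametricDist K] in
theorem const (a : K) : IsUniformLimit U fun _ => a := by
  intro ε hε
  exact ⟨C a, 1, 0, by simp, by simp, by simp, by simp, by simp, by simp [hε.le], by simp [hε.le]⟩

theorem sum {ι : Type*} {s : Finset ι} {F : ι → OnePoint K → K}
    (hF : ∀ i ∈ s, IsUniformLimit U (F i)) : IsUniformLimit U fun z => ∑ i ∈ s, F i z := by
  classical
  induction s using Finset.induction_on with
  | empty => simpa using const (U := U) (0 : K)
  | insert i s hi ih =>
    simp only [Finset.sum_insert hi]
    exact (hF i (Finset.mem_insert_self i s)).add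
      (ih fun j hj => hF j (Finset.mem_insert_of_mem hj))

omit [IsUltrametricDist K] in
theorem congr (hf : IsUniformLimit U f) (h : ∀ w : K, (w : OnePoint K) ∈ U → g w = f w)
    (hi : g OnePoint.infty = f OnePoint.infty) : IsUniformLimit U g := by
  intro ε hε
  obtain ⟨P, Q, m, hP, hQ, hQm, hQ1, hQX, hfX, hfi⟩ := hf ε hε
  exact ⟨P, Q, m, hP, hQ, hQm, hQ1, hQX, fun w hw => by rw [h w hw]; exact hfX w hw,
    by rw [hi]; exact hfi⟩

/-- On the open disc `‖P‖ ≤ ε * ‖Q‖ ≤ ε`, so all coefficients of `P` are at most `ε`. On `U` this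
gives `‖P‖ ≤ ε * max 1 ‖w‖ ^ m ≤ ε * ‖Q‖`; at infinity the coefficient of degree `m` is the value.
-/
theorem eq_zero (hK : ∀ s < (1 : ℝ), ∃ w : K, s < ‖w‖ ∧ ‖w‖ < 1) (hf : IsUniformLimit U f)
    (hX : ∀ w : K, ‖w‖ < 1 → (w : OnePoint K) ∈ U) (h0 : ∀ w : K, ‖w‖ < 1 → f w = 0) :
    Set.EqOn f 0 U := by
  have key : ∀ z ∈ U, ∀ ε > 0, ‖f z‖ ≤ ε := fun z hz ε hε => by
    obtain ⟨P, Q, m, hP, hQ, hQm, hQ1, hQX, hfX, hfi⟩ := hf ε hε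
    have hcoeff : ∀ k, ‖P.coeff k‖ ≤ ε := norm_coeff_le_of_norm_eval_le hK fun w hw => by
      have h1 := hfX w (hX w hw)
      have h2 := eval_ne_zero_of_max_pow_le (hQX w (hX w hw))
      rw [h0 w hw, zero_sub, norm_neg, norm_div, div_le_iff₀ (norm_pos_iff.2 h2)] at h1
      exact h1.trans (mul_le_of_le_one_right hε.le (hQ1 w hw))
    induction z using OnePoint.rec with
    | infty =>
      have := (IsUltrametricDist.norm_add_le_max _ _).trans (max_le hfi (hcoeff m))
      rwa [sub_add_cancel] at this
    | coe w =>
      have h2 := eval_ne_zero_of_max_pow_le (hQX w hz)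
      have h3 : ‖P.eval w‖ ≤ ε * max 1 ‖w‖ ^ m := by
        rw [eval_eq_sum_range' (Nat.lt_succ_of_le hP)]
        refine IsUltrametricDist.norm_sum_le_of_forall_le_of_nonneg (by positivity) fun i hi => ?_
        rw [norm_mul, norm_pow]
        refine mul_le_mul (hcoeff i) ?_ (by positivity) hε.le
        exact (pow_le_pow_left₀ (norm_nonneg _) (le_max_right _ _) i).trans
          (pow_le_pow_right₀ (le_max_left _ _) (Nat.lt_succ_iff.1 (Finset.mem_range.1 hi)))
      have h4 : ‖P.eval w / Q.eval w‖ ≤ ε := by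
        rw [norm_div, div_le_iff₀ (norm_pos_iff.2 h2)]
        exact h3.trans (mul_le_mul_of_nonneg_left (hQX w hz) hε.le)
      have := (IsUltrametricDist.norm_add_le_max _ _).trans (max_le (hfX w hz) h4)
      rwa [sub_add_cancel] at this
  intro z hz
  exact norm_le_zero_iff.1 (le_of_forall_gt_imp_ge_of_dense fun ε hε => key z hz ε hε)

/-- The truncations have common denominator `(X - α) ^ (M + 1)` and a numerator of lower degree, so
they vanish at infinity. The tails are bounded by the tails of `b` since `‖w - α‖ ≥ 1` on `U`. -/
theorem principalPart [CompleteSpace K] {α : K} (hα : ‖α‖ ≤ 1)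
    (hX : ∀ w : K, (w : OnePoint K) ∈ U → max 1 ‖w‖ ≤ ‖w - α‖) {b : ℕ → K}
    (hb : Tendsto b atTop (𝓝 0)) :
    IsUniformLimit U fun z => z.elim 0 fun w => ∑' m, b m / (w - α) ^ (m + 1) := by
  intro ε hε
  obtain ⟨M, hM⟩ := eventually_atTop.1
    ((tendsto_zero_iff_norm_tendsto_zero.1 hb).eventually_le_const hε)
  have hdeg : ((X - C α) ^ (M + 1) : K[X]).natDegree = M + 1 := by
    rw [natDegree_pow, natDegree_X_sub_C, mul_one]
  have hdegP : (∑ m ∈ Finset.range (M + 1), C (b m) * (X - C α) ^ (M - m) : K[X]).natDegree ≤ M :=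
    natDegree_sum_le_of_forall_le _ _ fun m _ => by
      refine (natDegree_C_mul_le _ _).trans ?_
      rw [natDegree_pow, natDegree_X_sub_C, mul_one]
      exact Nat.sub_le _ _
  refine ⟨∑ m ∈ Finset.range (M + 1), C (b m) * (X - C α) ^ (M - m), (X - C α) ^ (M + 1), M + 1,
    hdegP.trans (Nat.le_succ M), hdeg.le, ?_, fun w hw => ?_, fun w hw => ?_, fun w hw => ?_, ?_⟩
  · have := ((monic_X_sub_C α).pow (M + 1)).coeff_natDegree
    rwa [hdeg] at this
  · rw [eval_pow, eval_sub, eval_X, eval_C, norm_pow, sub_eq_add_neg]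
    refine pow_le_one₀ (norm_nonneg _) ((IsUltrametricDist.norm_add_le_max _ _).trans ?_)
    rw [norm_neg]
    exact max_le hw.le hα
  · rw [eval_pow, eval_sub, eval_X, eval_C, norm_pow]
    exact pow_le_pow_left₀ (by positivity) (hX w hw) _
  · have h1 : 1 ≤ ‖w - α‖ := (le_max_left _ _).trans (hX w hw)
    have h0 : w - α ≠ 0 := norm_pos_iff.1 (zero_lt_one.trans_le h1)
    have hle : ∀ m, ‖b m / (w - α) ^ (m + 1)‖ ≤ ‖b m‖ := fun m => by
      rw [norm_div, norm_pow]
      exact div_le_self (norm_nonneg _) (one_le_pow₀ h1)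
    have hsum : Summable fun m => b m / (w - α) ^ (m + 1) := by
      refine summable_of_cofinite ?_
      rw [Nat.cofinite_eq_atTop]
      exact tendsto_zero_of_norm_le hb hle
    have hPQ : (∑ m ∈ Finset.range (M + 1), C (b m) * (X - C α) ^ (M - m) : K[X]).eval w /
        ((X - C α) ^ (M + 1) : K[X]).eval w =
        ∑ m ∈ Finset.range (M + 1), b m / (w - α) ^ (m + 1) := by
      rw [eval_finsetSum, Finset.sum_div]
      refine Finset.sum_congr rfl fun m hm => ?_
      have hmM : M + 1 = (M - m) + (m + 1) := by
        have := Finset.mem_range.1 hm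
        omega
      simp only [eval_mul, eval_pow, eval_sub, eval_X, eval_C]
      rw [hmM, pow_add, mul_comm (b m), mul_div_mul_left _ _
        (pow_ne_zero _ h0)]
    simp only [OnePoint.elim_some]
    rw [hPQ, ← hsum.sum_add_tsum_nat_add (M + 1), add_sub_cancel_left]
    refine IsUltrametricDist.norm_tsum_le_of_forall_le_of_nonneg hε.le fun m => ?_
    exact (hle _).trans (hM _ (by omega))
  · rw [coeff_eq_zero_of_natDegree_lt (Nat.lt_succ_of_le hdegP)]
    simp [hε.le]

end IsUniformLimit

end Uniqueness

/-! ### Choice of the radius, existence and uniqueness of the extension. -/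

section Main

variable {p : ℕ} [Fact p.Prime]

theorem exists_norm_lt_one_and_lt {s : ℝ} (hs : s < 1) :
    ∃ γ : ℂ_[p], s < ‖γ‖ ∧ ‖γ‖ < 1 ∧ ‖(p : ℂ_[p])‖ < ‖γ‖ ^ p := by
  obtain ⟨N, hN⟩ := exists_pow_lt_of_lt_one (norm_natCast_self_pos (p := p))
    (max_lt hs zero_lt_one)
  -- A root of `p` of order `N + p + 1`: the part `N` pushes `‖γ‖` above `s`, and an order above `p`
  -- gives `‖p‖ < ‖γ‖ ^ p`.
  obtain ⟨γ, hγ⟩ := IsAlgClosed.exists_pow_nat_eq (p : ℂ_[p]) (n := N + p + 1) (Nat.succ_pos _)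
  have hnorm : ‖γ‖ ^ (N + p + 1) = ‖(p : ℂ_[p])‖ := by rw [← norm_pow, hγ]
  have h1 : ‖γ‖ < 1 := by
    by_contra! h
    exact (one_le_pow₀ h).not_gt (hnorm ▸ norm_natCast_self_lt_one)
  have h0 : 0 < ‖γ‖ := by
    refine norm_pos_iff.2 fun h => ?_
    have := norm_natCast_self_pos (p := p)
    rw [← hnorm, h, norm_zero, zero_pow (Nat.succ_ne_zero _)] at this
    exact lt_irrefl _ this
  refine ⟨γ, ?_, h1, ?_⟩
  · by_contra! h
    have h2 : ‖γ‖ ^ (N + p + 1) ≤ max s 0 ^ N :=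
      (pow_le_pow_of_le_one h0.le h1.le (by omega)).trans
        (pow_le_pow_left₀ h0.le (h.trans (le_max_left _ _)) N)
    rw [hnorm] at h2
    exact h2.not_gt hN
  · rw [← hnorm]
    exact pow_lt_pow_right_of_lt_one₀ h0 h1 (by omega)

theorem norm_center_eq_one {x y : ℂ_[p]} (hx : ‖x‖ = 1) (hxy : ‖x - y‖ < 1) : ‖y‖ = 1 := by
  have h : ‖x - (x - y)‖ = ‖x‖ := by
    rw [norm_sub_rev]
    exact norm_sub_eq_right_of_norm_lt (hx ▸ hxy)
  rwa [sub_sub_cancel, hx] at h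

theorem one_le_norm_sub_of_norm_lt_one {w y : ℂ_[p]} (hw : ‖w‖ < 1) (hy : ‖y‖ = 1) :
    ‖w - y‖ = 1 := by
  rw [norm_sub_eq_right_of_norm_lt (hy ▸ hw), hy]

/-- A rigid function may come with any presentation of the set, so the presentation is first pinned
down by testing points: infinity forces `δ₀ = 0`, each centre lies outside the set and hence in one
of the removed residue discs, and the point `0` forces `δ i ≤ 1`. -/
theorem IsRigidAnalyticOn.isUniformLimit {N : ℕ} [NeZero N] {s : Fin N → ResField p}
    (hs : ∀ j, ‖liftRes (s j)‖ = 1) {f : P1 p → ℂ_[p]}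
    (hf : IsRigidAnalyticOn (affinoid (fun j => liftRes (s j)) (fun _ => 1) 0) f) :
    IsUniformLimit (affinoid (fun j => liftRes (s j)) (fun _ => 1) 0) f := by
  obtain ⟨M, α, δ, δ₀, a, b, hδ, -, hX, ha, -, hb, hfw, hfi⟩ := hf
  set U := affinoid (fun j => liftRes (s j)) (fun _ => 1) 0 with hU
  have hinfty : (OnePoint.infty : P1 p) ∈ U := infty_mem_affinoid_zero
  have hδ₀ : δ₀ = 0 := (hX ▸ hinfty : (OnePoint.infty : P1 p) ∈ affinoid α δ δ₀).1 rfl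
  subst hδ₀
  have hα : ∀ i, ∃ j, ‖α i - liftRes (s j)‖ < 1 := fun i => by
    by_contra! hcon
    have h1 : ((α i : ℂ_[p]) : P1 p) ∈ U := mem_affinoid_zero_coe.2 hcon
    rw [hX, mem_affinoid_zero_coe] at h1
    have h2 := h1 i
    rw [sub_self, norm_zero] at h2
    exact (hδ i).not_ge h2
  have hα1 : ∀ i, ‖α i‖ = 1 := fun i => by
    obtain ⟨j, hj⟩ := hα i
    exact norm_center_eq_one (hs j) (by rwa [norm_sub_rev])
  have hδ1 : ∀ i, δ i ≤ 1 := fun i => by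
    have h1 : ((0 : ℂ_[p]) : P1 p) ∈ U := mem_affinoid_zero_coe.2 fun j =>
      (one_le_norm_sub_of_norm_lt_one (by simp) (hs j)).ge
    rw [hX, mem_affinoid_zero_coe] at h1
    have h2 := h1 i
    rwa [zero_sub, norm_neg, hα1] at h2
  have hdist : ∀ i, ∀ w : ℂ_[p], (w : P1 p) ∈ U → max 1 ‖w‖ ≤ ‖w - α i‖ := fun i w hw => by
    obtain ⟨j, hj⟩ := hα i
    have hwj : 1 ≤ ‖w - liftRes (s j)‖ := mem_affinoid_zero_coe.1 hw j
    rcases le_or_gt ‖w‖ 1 with h | h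
    · rw [max_eq_left h]
      have h1 : w - α i = -((α i - liftRes (s j)) - (w - liftRes (s j))) := by ring
      rwa [h1, norm_neg, norm_sub_eq_right_of_norm_lt (hj.trans_le hwj)]
    · rw [max_eq_right h.le, norm_sub_rev, norm_sub_eq_right_of_norm_lt (by rwa [hα1])]
  have hb0 : ∀ i, Tendsto (b i) atTop (𝓝 0) := fun i => by
    refine squeeze_zero_norm (fun m => ?_) (hb i)
    refine le_mul_of_one_le_right (norm_nonneg _) (one_le_pow₀ ?_)
    rw [one_div]
    exact (one_le_inv₀ (hδ i)).2 (hδ1 i)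
  refine ((IsUniformLimit.const (a 0)).add (IsUniformLimit.sum (s := Finset.univ) fun i _ =>
    IsUniformLimit.principalPart (hα1 i).le (hdist i) (hb0 i))).congr (fun w hw => ?_) ?_
  · rw [hfw w hw, tsum_eq_single 0 fun m hm => by
      rw [ha rfl m (Nat.one_le_iff_ne_zero.2 hm), zero_mul]]
    simp
  · rw [hfi hinfty]
    simp

variable {r : ℕ} {ξ : Fin (r + 1) → ℂ_[p]}

/-- The residue classes of the inverses of the `ξ_j ξ_{j+1} ⋯ ξ_r`. -/
theorem exists_residues (hξ : ∀ j, ‖ξ j‖ = 1) : ∃ s : Fin (r + 1) → ResField p,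
    singularSet ξ = (Set.range fun j => (s j : P1Res p)) ∧
      ∀ j, ‖(tailProd ξ j)⁻¹ - liftRes (s j)‖ < 1 := by
  have h : ∀ j, ∃ s : ResField p, red (((tailProd ξ j)⁻¹ : ℂ_[p]) : P1 p) = (s : P1Res p) :=
    fun j => ⟨_, red_coe_of_norm_le_one (by rw [norm_inv, norm_tailProd hξ, inv_one])⟩
  choose s hs using h
  exact ⟨s, congrArg Set.range (funext hs), fun j => red_coe_eq_coe_iff.1 (hs j)⟩

theorem exists_unique_rigid_of_mem_polarRing {S : Set (P1Res p)} {N : ℕ} [NeZero N]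
    {s : Fin N → ResField p} (hS : S = Set.range fun j => (s j : P1Res p))
    (hs : ∀ j, ‖liftRes (s j)‖ = 1) {γ : ℂ_[p]} (hγ0 : γ ≠ 0) (hγ : ‖γ‖ < 1) {c : ℂ_[p]}
    (hc : c ≠ 0) {f₀ : ℂ_[p] → ℂ_[p]}
    (hf : (fun w : {w : ℂ_[p] // ‖w‖ < 1} => c * f₀ w) ∈ polarRing (fun j => liftRes (s j)) hs
      (fun _ _ => liftRes_eq_or_norm_sub_eq_one _ _) γ hγ.le) :
    ∃ f : P1 p → ℂ_[p], IsRigid S f ∧ (∀ z : ℂ_[p], ‖z‖ < 1 → f (z : P1 p) = f₀ z) ∧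
      IsOverconvergent S f ∧
      ∀ g : P1 p → ℂ_[p], IsRigid S g → (∀ z : ℂ_[p], ‖z‖ < 1 → g (z : P1 p) = f₀ z) →
        Set.EqOn g f (tube S)ᶜ := by
  subst hS
  obtain ⟨a, b, hb, hab⟩ := exists_polarExpansion_of_mem_polarRing hs
    (fun _ _ => liftRes_eq_or_norm_sub_eq_one _ _) hγ0 hγ.le hc (f := fun w => f₀ w) hf
  have hγpos : 0 < ‖γ‖ := norm_pos_iff.2 hγ0
  have hrigid : IsRigid (Set.range fun j => (s j : P1Res p))
      (polarExpansion (fun j => liftRes (s j)) a b) := by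
    rw [IsRigid, compl_tube_range_eq_affinoid]
    refine isRigidAnalyticOn_polarExpansion (fun _ => zero_lt_one) a fun i => ?_
    refine squeeze_zero (fun m => by positivity) (fun m => ?_) (hb i)
    refine mul_le_mul_of_nonneg_left (pow_le_pow_left₀ (by norm_num) ?_ _) (norm_nonneg _)
    exact one_div_le_one_div_of_le hγpos hγ.le
  refine ⟨polarExpansion (fun j => liftRes (s j)) a b, hrigid, fun z hz => hab ⟨z, hz⟩,
    ⟨liftRes, ‖γ‖, polarExpansion (fun j => liftRes (s j)) a b, fun t _ => red_liftRes t, hγpos,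
      hγ, ?_, fun _ _ => rfl⟩, fun g hg hgz => ?_⟩
  · rw [shrunkComplement_range_eq_affinoid]
    exact isRigidAnalyticOn_polarExpansion (fun _ => hγpos) a hb
  · rw [IsRigid, compl_tube_range_eq_affinoid] at hg hrigid
    rw [compl_tube_range_eq_affinoid]
    -- The difference of two extensions is again a uniform limit, and it vanishes on the open unit
    -- disc.
    have hlim := (hg.isUniformLimit hs).add (hrigid.isUniformLimit hs).neg
    have hzero := hlim.eq_zero
      (fun s hs => (exists_norm_lt_one_and_lt (p := p) hs).imp fun _ h => ⟨h.1, h.2.1⟩)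
      (fun w hw => mem_affinoid_zero_coe.2 fun j =>
        (one_le_norm_sub_of_norm_lt_one hw (hs j)).ge)
      (fun w hw => by
        rw [hgz w hw, show polarExpansion _ a b (w : P1 p) = f₀ w from hab ⟨w, hw⟩,
          add_neg_cancel])
    intro z hz
    exact add_neg_eq_zero.1 (hzero hz)

theorem mul_partialTMPL_mem_polarRing {α n : Fin (r + 1) → ℕ} (hα : ∀ j, 0 < α j ∧ α j < p)
    (hξ : ∀ j, ‖ξ j‖ = 1) {s : Fin (r + 1) → ResField p} (hs : ∀ j, ‖liftRes (s j)‖ = 1)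
    {γ : ℂ_[p]} (hγ : ‖γ‖ < 1) (hpγ : ‖(p : ℂ_[p])‖ < ‖γ‖ ^ p)
    (hsγ : ∀ j, ‖(tailProd ξ j)⁻¹ - liftRes (s j)‖ < ‖γ‖) :
    (fun w : {w : ℂ_[p] // ‖w‖ < 1} => (γ ^ p) ^ (r + 1) * partialTMPL α n ξ w) ∈
      polarRing (fun j => liftRes (s j)) hs
        (fun _ _ => liftRes_eq_or_norm_sub_eq_one _ _) γ hγ.le := by
  have hp : p.Prime := Fact.out
  obtain ⟨g, hg⟩ := exists_isGapSequence hα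
  simp_rw [partialTMPL_eq_progressionSum hg]
  exact pow_mul_progressionSum_mem_polarRing hs _ hγ.le hp hpγ (norm_tailProd hξ)
    (fun i => ⟨i, hsγ i⟩) hg.le (hg.gapWeight_mem ℂ_[p] hp n hα)

end Main

end RigidTMPL

theorem mainTheorem10 (p : ℕ) [Fact p.Prime] (r : ℕ) (n : Fin (r + 1) → ℕ) (hn : ∀ j, 1 ≤ n j)
    (ξ : Fin (r + 1) → ℂ_[p]) (hξ : ∀ j, ‖ξ j‖ = 1) :
    ((∀ z : ℂ_[p], ‖z‖ < 1 →
        Summable fun k : RigidTMPL.indexSet p r => RigidTMPL.term n ξ z k) ∧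
      ∃ f : RigidTMPL.P1 p → ℂ_[p],
        RigidTMPL.IsRigid (RigidTMPL.singularSet ξ) f ∧
        (∀ z : ℂ_[p], ‖z‖ < 1 → f (z : RigidTMPL.P1 p) = RigidTMPL.rigidTMPL n ξ z) ∧
        RigidTMPL.IsOverconvergent (RigidTMPL.singularSet ξ) f ∧
        ∀ g : RigidTMPL.P1 p → ℂ_[p], RigidTMPL.IsRigid (RigidTMPL.singularSet ξ) g →
          (∀ z : ℂ_[p], ‖z‖ < 1 → g (z : RigidTMPL.P1 p) = RigidTMPL.rigidTMPL n ξ z) →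
          Set.EqOn g f (RigidTMPL.tube (RigidTMPL.singularSet ξ))ᶜ) ∧
    ∀ α : Fin (r + 1) → ℕ, (∀ j, 0 < α j ∧ α j < p) →
      (∀ z : ℂ_[p], ‖z‖ < 1 →
        Summable fun k : RigidTMPL.partialIndexSet p α => RigidTMPL.term n ξ z k) ∧
      ∃ f : RigidTMPL.P1 p → ℂ_[p],
        RigidTMPL.IsRigid (RigidTMPL.singularSet ξ) f ∧
        (∀ z : ℂ_[p], ‖z‖ < 1 → f (z : RigidTMPL.P1 p) = RigidTMPL.partialTMPL α n ξ z) ∧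
        RigidTMPL.IsOverconvergent (RigidTMPL.singularSet ξ) f ∧
        ∀ g : RigidTMPL.P1 p → ℂ_[p], RigidTMPL.IsRigid (RigidTMPL.singularSet ξ) g →
          (∀ z : ℂ_[p], ‖z‖ < 1 → g (z : RigidTMPL.P1 p) = RigidTMPL.partialTMPL α n ξ z) →
          Set.EqOn g f (RigidTMPL.tube (RigidTMPL.singularSet ξ))ᶜ := by
  have hp : p.Prime := Fact.out
  obtain ⟨s, hS, hsξ⟩ := RigidTMPL.exists_residues hξ
  have hs : ∀ j, ‖RigidTMPL.liftRes (s j)‖ = 1 := fun j =>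
    RigidTMPL.norm_center_eq_one (by rw [norm_inv, RigidTMPL.norm_tailProd hξ, inv_one]) (hsξ j)
  -- Finitely many poles have a common bound `ρ < 1` for their distances to the lifts. Any `γ` with
  -- `ρ < ‖γ‖ < 1` and `‖p‖ < ‖γ‖ ^ p` then gives a radius that serves all `α` at once.
  obtain ⟨ρ, -, hρ1, hρ⟩ := RigidTMPL.exists_bound_lt_one hsξ
  obtain ⟨γ, hργ, hγ, hpγ⟩ := RigidTMPL.exists_norm_lt_one_and_lt (p := p) hρ1
  have hsγ := fun j => (hρ j).trans_lt hργ
  have hγ0 : γ ≠ 0 := by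
    rintro rfl
    rw [norm_zero, zero_pow hp.ne_zero] at hpγ
    exact (norm_nonneg _).not_gt hpγ
  have hc : (γ ^ p) ^ (r + 1) ≠ 0 := pow_ne_zero _ (pow_ne_zero _ hγ0)
  have hmem := fun (α : Fin (r + 1) → ℕ) (hα : ∀ j, 0 < α j ∧ α j < p) =>
    RigidTMPL.mul_partialTMPL_mem_polarRing (n := n) hα hξ hs hγ hpγ hsγ
  refine ⟨⟨fun z hz => RigidTMPL.summable_term hξ subset_rfl hz, ?_⟩, fun α hα =>
    ⟨fun z hz => RigidTMPL.summable_term hξ (RigidTMPL.partialIndexSet_subset hp hα) hz,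
      RigidTMPL.exists_unique_rigid_of_mem_polarRing hS hs hγ0 hγ hc (hmem α hα)⟩⟩
  refine RigidTMPL.exists_unique_rigid_of_mem_polarRing hS hs hγ0 hγ hc ?_
  -- Since `γ` and the factor `(γ ^ p) ^ (r + 1)` do not depend on `α`, the sum over all residue
  -- tuples stays in the same ring.
  convert Subring.sum_mem _ fun α (hα : α ∈ Fintype.piFinset fun _ : Fin (r + 1) =>
    Finset.Ioo 0 p) => hmem α (by simpa using hα) using 1
  funext w
  rw [RigidTMPL.rigidTMPL_eq_sum hξ w.2, Finset.mul_sum, Finset.sum_apply]
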